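/- Let $\mathbb K$ be a field of characteristic zero with algebraic closure $\overline{\mathbb K}$, let $\mathbb N=\{1,2,\dots\}$, and let $\sigma:f(x)\mapsto f(x+1)$. Denominators, gcd's and lcm's are normalized to be monic, $\deg 0=-1$, and $f\in\mathbb K(x)$ is proper if its numerator has smaller degree than its denominator. A polynomial $b\neq0$ is squarefree if $\gcd(b,b')=1$, and shiftfree if $\gcd(b,\sigma^\ell(b))=1$ for all $\ell\in\mathbb N$. For $\alpha\in\overline{\mathbb K}$ put $\omega(\alpha)=\alpha+\mathbb Z$, and let $\overline{\mathbb K}/\mathbb Z$ be the set of these orbits. If $$f=p+\sum_{k\in\mathbb N}\sum_{\alpha\in\overline{\mathbb K}}\frac{c_k(\alpha)}{(x-\alpha)^k}\qquad(p\in\mathbb K[x])$$ is the complete partial fraction decomposition of $f\in\mathbb K(x)$, its discrete residue of order $k$ at $\omega\in\overline{\mathbb K}/\mathbb Z$ is $\mathrm{dres}(f,\omega,k)=\sum_{\alpha\in\omega}c_k(\alpha)$. Consider the following procedures. $\mathtt{HermiteReduction}(f)$, for proper $f$, returns the unique pair $(g,h)$ of proper rational functions with $f=\frac{d}{dx}g+h$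 such that $h$ has squarefree denominator. $\mathtt{HermiteList}(f)$, for proper $f\ne0$: set $m\gets0$, $g\gets f$; while $g\ne0$, do $(g,\hat f_{m+1})\gets\mathtt{HermiteReduction}(g)$ and $m\gets m+1$; return $(f_1,\dots,f_m)$ with $f_k=(-1)^{k-1}(k-1)!\,\hat f_k$. $\mathtt{ShiftSet}(b)$, for squarefree $b$: if $\deg b\le1$ return $\emptyset$; otherwise let $R(z)=\mathrm{Resultant}_x(b(x),b(x+z))$ and $\tilde R(z)=R(z)/\bigl(z\gcd_z(R,\frac{dR}{dz})\bigr)$, which is an even polynomial, let $T(z)=\tilde R(z^{1/2})$, and return $\{\ell\in\mathbb N: T(\ell^2)=0\}$. $\mathtt{SimpleReduction}(f)$, for proper $f$ with squarefree denominator $b$: let $S=\mathtt{ShiftSet}(b)$. If $S=\emptyset$ return $f$. Otherwise let $G=\mathrm{lcm}\bigl(\gcd(b,\sigma^{-\ell}(b)): \ell\in S\bigr)$, $b_0=b/G$, $b_\ell=\gcd(\sigma^{-\ell}(b_0),b)$ for $\ell\in S$, and $N=\{0\}\cup\{\ell\in S:\deg b_\ell\ge1\}$; compute the unique nonzero polynomials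 $a_\ell$ $(\ell\in N)$ with $\deg a_\ell<\deg b_\ell$ and $f=\sum_{\ell\in N}a_\ell/b_\ell$ (where $\prod_{\ell\in N}b_\ell=b$), and return $\sum_{\ell\in N}\sigma^\ell(a_\ell/b_\ell)$. $\mathtt{FirstResidues}(f)$, for proper $f$ with squarefree denominator: $\mathtt{FirstResidues}(0)=(1,0)$; for $f=a/b\neq0$ in lowest terms it returns $(b,r)$, where $r\in\mathbb K[x]$ is the unique polynomial with $\deg r<\deg b$ and $r\,b'\equiv a\pmod b$. $\mathtt{DiscreteResidues}(f)$, for proper $f\neq0$: let $(f_1,\dots,f_m)=\mathtt{HermiteList}(f)$; for $k=1,\dots,m$ let $\bar f_k=\mathtt{SimpleReduction}(f_k)$ and $(B_k,D_k)=\mathtt{FirstResidues}(\bar f_k)$; return $\bigl((B_1,D_1),\dots,(B_m,D_m)\bigr)$. Theorem. For every proper $0\ne f\in\mathbb K(x)$, the procedure $\mathtt{DiscreteResidues}(f)$ is well defined (every step is possible with a unique result, and every procedure is called on inputs of the kind it requires), it terminates, and its output $\bigl((B_1,D_1),\dots,(B_m,D_m)\bigr)\in(\mathbb K[x]\times\mathbb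 K[x])^m$ is a $\mathbb K$-rational system of discrete residues of $f$, that is: 1. $f$ has no poles (in $\overline{\mathbb K}$) of order higher than $m$; 2. for $1\le k\le m$, the polynomial $B_k$ is nonzero, squarefree and shiftfree, and $\deg B_k>\deg D_k$; 3. if $1\le k\le m$ and $\omega\in\overline{\mathbb K}/\mathbb Z$ contains no root of $B_k$, then $\mathrm{dres}(f,\omega,k)=0$; 4. if $1\le k\le m$ and $\alpha\in\overline{\mathbb K}$ satisfies $B_k(\alpha)=0$, then $\mathrm{dres}(f,\omega(\alpha),k)=D_k(\alpha)$. -/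

import Mathlib

namespace DiscreteResidues

open Polynomial

noncomputable section

/-! ### Rational functions and polynomials -/

section Basic

variable {K : Type*} [Field K]

/-- A polynomial `b` is squarefree if `b ≠ 0` and `gcd(b, b') = 1`. -/
def IsSquarefreePoly (b : K[X]) : Prop :=
  b ≠ 0 ∧ IsCoprime b (derivative b)

/-- The power `σⁿ` of the shift automorphism on polynomials: `b(x) ↦ b(x + n)`, for `n : ℤ`. -/
def shiftPoly (n : ℤ) (b : K[X]) : K[X] :=
  taylor (n : K) b

/-- A polynomial is shiftfree if `gcd(b, σ^ℓ(b)) = 1` for every positive integer `ℓ`, that is,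
if its dispersion is `0`. -/
def IsShiftfree (b : K[X]) : Prop :=
  ∀ ℓ : ℕ, 1 ≤ ℓ → IsCoprime b (shiftPoly (ℓ : ℤ) b)

/-- A rational function is proper if its numerator has smaller degree than its denominator
(the zero polynomial has degree `⊥`, so `0` is proper). -/
def IsProper (f : RatFunc K) : Prop :=
  f.num.degree < f.denom.degree

/-- The quotient `a / b` of two polynomials, as a rational function. -/
def frac (a b : K[X]) : RatFunc K :=
  algebraMap K[X] (RatFunc K) a / algebraMap K[X] (RatFunc K) b

/-- The derivation `d/dx` on rational functions, by the quotient rule. -/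
def deriv (f : RatFunc K) : RatFunc K :=
  frac (derivative f.num * f.denom - f.num * derivative f.denom) (f.denom ^ 2)

/-- The power `σⁿ` of the shift automorphism on rational functions: `f(x) ↦ f(x + n)`. -/
def shift (n : ℤ) : RatFunc K →+* RatFunc K :=
  RatFunc.mapRingHom (taylorAlgHom (n : K))
    (nonZeroDivisors_le_comap_nonZeroDivisors_of_injective _ (taylorEquiv (n : K)).injective)

end Basic

/-! ### Discrete residues -/

section Residues

variable {K : Type*} [Field K] (L : Type*) [Field L] [Algebra K L]

/-- The inclusion `K(x) → L(x)` for a field extension `L` of `K`. -/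
def baseChange : RatFunc K →+* RatFunc L :=
  RatFunc.mapRingHom (mapRingHom (algebraMap K L))
    (nonZeroDivisors_le_comap_nonZeroDivisors_of_injective _
      (Polynomial.map_injective _ (algebraMap K L).injective))

/-- The set `L / ℤ` of orbits of `L` under translation by integers. The orbit `ω(α)` of `α : L` is
the class `(α : Orbit L)`. -/
abbrev Orbit : Type _ := L ⧸ AddSubgroup.zmultiples (1 : L)

variable {L} in
/-- `f = p + ∑_{k ≥ 1} ∑_{α ∈ L} c_k(α) / (x - α)^k`, where `p` is a polynomial and all but finitely
many of the `c_k(α) = c (k, α)` are zero. For `L` an algebraic closure of `K` this is the complete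
partial fraction decomposition of `f`; it exists and is unique. -/
def IsPartialFractionDecomposition (f : RatFunc K) (p : K[X]) (c : ℕ+ × L →₀ L) : Prop :=
  baseChange L f = algebraMap L[X] (RatFunc L) (p.map (algebraMap K L)) +
    c.sum fun kα v => frac (C v) ((X - C kα.2) ^ (kα.1 : ℕ))

open scoped Classical in
/-- The coefficients `c_k(α)` in the complete partial fraction decomposition of `f`. -/
def partialFractionCoeff (f : RatFunc K) : ℕ+ × L →₀ L :=
  if h : ∃ c : ℕ+ × L →₀ L, ∃ p : K[X], IsPartialFractionDecomposition f p c then h.choose else 0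

variable {L} in
/-- The discrete residue `dres(f, ω, k) = ∑_{α ∈ ω} c_k(α)` of order `k ≥ 1` at the orbit `ω`. The
sum has only finitely many nonzero terms. -/
def dres (f : RatFunc K) (ω : Orbit L) (k : ℕ+) : L :=
  ∑ᶠ (α : L) (_ : (α : Orbit L) = ω), partialFractionCoeff L f (k, α)

/-- The list `(B₁, D₁), …, (B_m, D_m)` is a `K`-rational system of discrete residues of `f`. The
pair `(B_k, D_k)` is the list entry with index `i = k - 1`, so that `k = i.succPNat`. -/
structure IsRationalSystem (f : RatFunc K) (s : List (K[X] × K[X])) : Prop where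
  /-- `f` has no poles of order higher than `m`. -/
  pole_order_le : ∀ α : L, (f.denom.map (algebraMap K L)).rootMultiplicity α ≤ s.length
  ne_zero : ∀ (i : ℕ) (hi : i < s.length), s[i].1 ≠ 0
  squarefree : ∀ (i : ℕ) (hi : i < s.length), IsSquarefreePoly s[i].1
  shiftfree : ∀ (i : ℕ) (hi : i < s.length), IsShiftfree s[i].1
  degree_lt : ∀ (i : ℕ) (hi : i < s.length), s[i].2.degree < s[i].1.degree
  dres_eq_zero : ∀ (i : ℕ) (hi : i < s.length) (ω : Orbit L),
    (∀ α : L, (α : Orbit L) = ω → aeval α s[i].1 ≠ 0) → dres f ω i.succPNat = 0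
  dres_eq_eval : ∀ (i : ℕ) (hi : i < s.length) (α : L),
    aeval α s[i].1 = 0 → dres f (α : Orbit L) i.succPNat = aeval α s[i].2

end Residues

/-! ### The procedures

Each procedure is described by the relation between its inputs and the outputs of its terminating
runs. A run exists only if every procedure is called on inputs that meet its requirements. -/

section Algorithms

attribute [local instance] UniqueFactorizationMonoid.toNormalizedGCDMonoid

variable {K : Type*} [Field K]

open scoped Classical in
/-- The monic greatest common divisor of two polynomials. -/
def polyGcd (p q : K[X]) : K[X] := gcd p q

open scoped Classical in
/-- The monic least common multiple of a finite family of nonzero polynomials. -/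
def polyLcm (S : Finset ℕ) (p : ℕ → K[X]) : K[X] := S.lcm p

/-- `HermiteReduction(f) = (g, h)`: the proper rational functions `g`, `h` with `f = dg/dx + h` such
that `h` has squarefree denominator. -/
structure HermiteReduction (f g h : RatFunc K) : Prop where
  proper : IsProper f
  proper_fst : IsProper g
  proper_snd : IsProper h
  eq : f = deriv g + h
  squarefree : IsSquarefreePoly h.denom

/-- The loop `while g ≠ 0 do (g, f̂_{m+1}) ← HermiteReduction(g); m ← m + 1`, started at `g`,
terminates and produces the list of the `f̂`. -/
inductive HermiteLoop : RatFunc K → List (RatFunc K) → Prop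
  | done : HermiteLoop 0 []
  | step {g g' h : RatFunc K} {l : List (RatFunc K)} :
      g ≠ 0 → HermiteReduction g g' h → HermiteLoop g' l → HermiteLoop g (h :: l)

/-- `HermiteList(f) = (f₁, …, f_m)`, where `f_k = (-1)^(k-1) (k-1)! f̂_k`. The list index is
`i = k - 1`. -/
def HermiteList (f : RatFunc K) (l : List (RatFunc K)) : Prop :=
  f ≠ 0 ∧ IsProper f ∧ ∃ fhat : List (RatFunc K), HermiteLoop f fhat ∧
    l = fhat.mapIdx fun i h => (-1) ^ i * (i.factorial : RatFunc K) * h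

/-- `R(z) = Resultant_x(b(x), b(x + z))`; here `taylor X` substitutes `x + z` for `x` in a
polynomial in `x` whose coefficients are polynomials in `z`. -/
def shiftResultant (b : K[X]) : K[X] :=
  resultant (b.map C) (taylor (X : K[X]) (b.map C))

/-- `R̃(z) = R(z) / (z gcd_z(R(z), R'(z)))`. -/
def reducedShiftResultant (b : K[X]) : K[X] :=
  shiftResultant b / (X * polyGcd (shiftResultant b) (derivative (shiftResultant b)))

/-- `T(z) = R̃(z^(1/2))`, for the even polynomial `R̃`. -/
def halvedShiftResultant (b : K[X]) : K[X] :=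
  contract 2 (reducedShiftResultant b)

/-- The procedure `ShiftSet`, run on the squarefree polynomial `b`, returns the finite set `S` of
positive integers. -/
def ShiftSet (b : K[X]) (S : Finset ℕ) : Prop :=
  IsSquarefreePoly b ∧
    ((b.natDegree ≤ 1 ∧ S = ∅) ∨
      (1 < b.natDegree ∧
        ∀ ℓ : ℕ, ℓ ∈ S ↔ 1 ≤ ℓ ∧ (halvedShiftResultant b).eval ((ℓ : K) ^ 2) = 0))

/-- `ParFrac(f; b_ℓ | ℓ ∈ N) = (a_ℓ | ℓ ∈ N)`, for a proper `f` whose squarefree denominator is the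
product of the monic non-constant polynomials `b_ℓ`. -/
structure ParFrac (f : RatFunc K) (N : Finset ℕ) (b a : ℕ → K[X]) : Prop where
  proper : IsProper f
  degree_denom : 1 ≤ f.denom.natDegree
  squarefree : IsSquarefreePoly f.denom
  monic : ∀ ℓ ∈ N, (b ℓ).Monic
  nonconstant : ∀ ℓ ∈ N, 1 ≤ (b ℓ).natDegree
  prod_eq : ∏ ℓ ∈ N, b ℓ = f.denom
  ne_zero : ∀ ℓ ∈ N, a ℓ ≠ 0
  degree_lt : ∀ ℓ ∈ N, (a ℓ).degree < (b ℓ).degree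
  eq : f = ∑ ℓ ∈ N, frac (a ℓ) (b ℓ)

/-- `b₀ = b / G`, where `G = lcm(g_ℓ | ℓ ∈ S)` and `g_ℓ = gcd(b, σ^(-ℓ)(b))`. -/
def initialFactor (b : K[X]) (S : Finset ℕ) : K[X] :=
  b / polyLcm S fun ℓ => polyGcd b (shiftPoly (-(ℓ : ℤ)) b)

/-- The polynomials `b_ℓ`: the `b₀` above for `ℓ = 0`, and `gcd(σ^(-ℓ)(b₀), b)` for `ℓ ≥ 1`. -/
def shiftFactor (b : K[X]) (S : Finset ℕ) (ℓ : ℕ) : K[X] :=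
  if ℓ = 0 then initialFactor b S
  else polyGcd (shiftPoly (-(ℓ : ℤ)) (initialFactor b S)) b

/-- `N = {0} ∪ {ℓ ∈ S | deg(b_ℓ) ≥ 1}`. -/
def shiftIndices (b : K[X]) (S : Finset ℕ) : Finset ℕ :=
  insert 0 (S.filter fun ℓ => 1 ≤ (shiftFactor b S ℓ).natDegree)

/-- The procedure `SimpleReduction`, run on `f`, returns `fbar`. -/
def SimpleReduction (f fbar : RatFunc K) : Prop :=
  IsProper f ∧ IsSquarefreePoly f.denom ∧
    ∃ S : Finset ℕ, ShiftSet f.denom S ∧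
      ((S = ∅ ∧ fbar = f) ∨
        (S ≠ ∅ ∧ ∃ a : ℕ → K[X],
          ParFrac f (shiftIndices f.denom S) (shiftFactor f.denom S) a ∧
          fbar = ∑ ℓ ∈ shiftIndices f.denom S,
            shift (ℓ : ℤ) (frac (a ℓ) (shiftFactor f.denom S ℓ))))

/-- `FirstResidues(f) = (b, r)`: for `f = a / b` nonzero and proper, in lowest terms, with `b` monic
and squarefree, `r` is the polynomial with `deg r < deg b` and `r b' ≡ a (mod b)`. By convention
`FirstResidues(0) = (1, 0)`. -/
def FirstResidues (f : RatFunc K) (br : K[X] × K[X]) : Prop :=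
  (f = 0 ∧ br = (1, 0)) ∨
    (f ≠ 0 ∧ IsProper f ∧ IsSquarefreePoly f.denom ∧ br.1 = f.denom ∧
      br.2.degree < f.denom.degree ∧ f.denom ∣ br.2 * derivative f.denom - f.num)

/-- The procedure `DiscreteResidues`, run on `f`, returns the list `s` of pairs `(B_k, D_k)`. -/
def DiscreteResiduesRun (f : RatFunc K) (s : List (K[X] × K[X])) : Prop :=
  ∃ l : List (RatFunc K), HermiteList f l ∧
    List.Forall₂ (fun fk BD => ∃ fbar, SimpleReduction fk fbar ∧ FirstResidues fbar BD) l s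

end Algorithms

end

end DiscreteResidues

namespace DiscreteResidues

open Polynomial

noncomputable section

/-! ### Arithmetic of quotients of polynomials -/

section Frac

variable {K : Type*} [Field K]

/-! Everything is read off from the numbers `polarCoeff k α`, the coefficients of `(x - α)^(-k)` in
Laurent expansions. Over an algebraically closed field they determine a proper function
(`IsProper.eq_of_polarCoeff_eq`), and for `k ≥ 1` they are the partial fraction coefficients
`c_k(α)` (`partialFractionCoeff_eq`).

Differentiation multiplies a coefficient of order `k` by `-k` and moves it to order `k + 1`, so a
derivative has no coefficient of order 1. Hence in `f = g' + h`, with `h` having only simple poles,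
`h` carries the first-order residues of `f` and `g` carries the higher ones with order lowered by
one. Iteration yields `HermiteLoop.polarCoeff_eq`; after the factor `(-1)^(k-1) (k-1)!`, the simple
residues of `f_k` are exactly the `c_k(α)`. This also gives uniqueness of Hermite reduction.
Existence is integration by parts, which lowers the exponent of a squarefree `q` and so makes the
loop stop.

The zeros of `R` are the differences of roots of `b`. Passing to `R̃` and `T` loses only
multiplicities and the zero difference, so `ShiftSet` finds the positive integer differences
(`ShiftSet.mem_iff`). The roots of `b₀` are then the roots of `b` having no other root of `b` to
their left in their orbit (`ShiftSet.aeval_initialFactor_eq_zero_iff`), and the roots of `b_ℓ` lie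
exactly `ℓ` to the right of these. So the `b_ℓ` split `b`, and applying `σ^ℓ` to the `ℓ`-th summand
moves its poles onto roots of `b₀`. Orbit sums of residues do not change
(`SimpleReduction.orbitSum_eq`), while each orbit keeps at most one pole. A discrete residue is
therefore an ordinary residue `a(α) / b'(α)`, which is the value at `α` of the polynomial `r` with
`r b' ≡ a` modulo `b`. -/

lemma algebraMap_ne_zero {b : K[X]} (hb : b ≠ 0) : algebraMap K[X] (RatFunc K) b ≠ 0 :=
  RatFunc.algebraMap_ne_zero hb

@[simp] lemma frac_zero_left (b : K[X]) : frac 0 b = 0 := by simp [frac]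

lemma frac_num_denom (f : RatFunc K) : frac f.num f.denom = f := RatFunc.num_div_denom f

lemma frac_eq_frac_iff {a b c d : K[X]} (hb : b ≠ 0) (hd : d ≠ 0) :
    frac a b = frac c d ↔ a * d = c * b := by
  rw [frac, frac, div_eq_div_iff (algebraMap_ne_zero hb) (algebraMap_ne_zero hd),
    ← map_mul, ← map_mul, (RatFunc.algebraMap_injective K).eq_iff]

lemma frac_eq_zero_iff {a b : K[X]} (hb : b ≠ 0) : frac a b = 0 ↔ a = 0 := by
  rw [← frac_zero_left b, frac_eq_frac_iff hb hb]
  simp [hb]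

lemma frac_add (a b c : K[X]) : frac (a + c) b = frac a b + frac c b := by
  simp [frac, add_div]

lemma frac_add_frac {a b c d : K[X]} (hb : b ≠ 0) (hd : d ≠ 0) :
    frac a b + frac c d = frac (a * d + b * c) (b * d) := by
  simp only [frac, div_add_div _ _ (algebraMap_ne_zero hb) (algebraMap_ne_zero hd), map_add,
    map_mul]

lemma frac_mul_mul_right {a b c : K[X]} (hc : c ≠ 0) :
    frac (a * c) (b * c) = frac a b := by
  simp only [frac, map_mul]
  rw [mul_div_mul_right _ _ (algebraMap_ne_zero hc)]

lemma frac_sum {ι : Type*} (s : Finset ι) (a : ι → K[X]) (b : K[X]) :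
    frac (∑ i ∈ s, a i) b = ∑ i ∈ s, frac (a i) b := by
  simp [frac, Finset.sum_div]

lemma denom_frac_dvd (a b : K[X]) : (frac a b).denom ∣ b := by
  rw [frac]
  exact RatFunc.denom_div_dvd a b

lemma num_mul_eq {a b : K[X]} (hb : b ≠ 0) :
    (frac a b).num * b = a * (frac a b).denom := by
  rw [← frac_eq_frac_iff (RatFunc.denom_ne_zero _) hb, frac_num_denom]

lemma isProper_frac {a b : K[X]} (h : a.degree < b.degree) : IsProper (frac a b) := by
  have hb : b ≠ 0 := by rintro rfl; simp at h
  by_cases ha : a = 0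
  · subst ha; simp [IsProper]
  have hf : frac a b ≠ 0 := by rwa [Ne, frac_eq_zero_iff hb]
  have h1 := congrArg natDegree (num_mul_eq (a := a) hb)
  rw [natDegree_mul (RatFunc.num_ne_zero hf) hb, natDegree_mul ha (RatFunc.denom_ne_zero _)] at h1
  have h2 := (natDegree_lt_natDegree_iff ha).2 h
  unfold IsProper
  rw [← natDegree_lt_natDegree_iff (RatFunc.num_ne_zero hf)]
  omega

lemma isProper_iff {f : RatFunc K} :
    IsProper f ↔ ∃ a b : K[X], a.degree < b.degree ∧ f = frac a b :=
  ⟨fun h => ⟨_, _, h, (frac_num_denom f).symm⟩, fun ⟨_, _, h, hf⟩ => hf ▸ isProper_frac h⟩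

lemma isProper_zero : IsProper (0 : RatFunc K) := by simp [IsProper]

lemma ne_zero_of_degree_lt {a b : K[X]} (h : a.degree < b.degree) : b ≠ 0 := by
  rintro rfl; simp at h

lemma degree_mul_lt {a b c : K[X]} (h : a.degree < b.degree) (hc : c ≠ 0) :
    (a * c).degree < (b * c).degree := by
  by_cases ha : a = 0
  · subst ha
    simpa [bot_lt_iff_ne_bot, degree_eq_bot, hc] using ne_zero_of_degree_lt h
  have hb := ne_zero_of_degree_lt h
  rw [← natDegree_lt_natDegree_iff (mul_ne_zero ha hc), natDegree_mul ha hc, natDegree_mul hb hc]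
  have := (natDegree_lt_natDegree_iff ha).2 h
  omega

lemma IsProper.add {f g : RatFunc K} (hf : IsProper f) (hg : IsProper g) : IsProper (f + g) := by
  obtain ⟨a, b, hab, rfl⟩ := isProper_iff.1 hf
  obtain ⟨c, d, hcd, rfl⟩ := isProper_iff.1 hg
  have hb := ne_zero_of_degree_lt hab
  have hd := ne_zero_of_degree_lt hcd
  rw [frac_add_frac hb hd]
  refine isProper_frac ((degree_add_le _ _).trans_lt (max_lt (degree_mul_lt hab hd) ?_))
  rw [mul_comm b c, mul_comm b d]
  exact degree_mul_lt hcd hb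

lemma IsProper.C_mul {f : RatFunc K} (hf : IsProper f) (v : K) : IsProper (RatFunc.C v * f) := by
  obtain ⟨a, b, hab, rfl⟩ := isProper_iff.1 hf
  rw [← RatFunc.algebraMap_C, frac, mul_div_assoc', ← map_mul]
  refine isProper_frac (lt_of_le_of_lt ?_ hab)
  by_cases hv : v = 0
  · simp [hv]
  · rw [degree_C_mul hv]

lemma IsProper.neg {f : RatFunc K} (hf : IsProper f) : IsProper (-f) := by
  have := hf.C_mul (-1)
  rwa [map_neg, map_one, neg_one_mul] at this

lemma IsProper.sub {f g : RatFunc K} (hf : IsProper f) (hg : IsProper g) : IsProper (f - g) :=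
  sub_eq_add_neg f g ▸ hf.add hg.neg

lemma IsProper.sum {ι : Type*} {s : Finset ι} {f : ι → RatFunc K} (h : ∀ i ∈ s, IsProper (f i)) :
    IsProper (∑ i ∈ s, f i) :=
  Finset.sum_induction f IsProper (fun _ _ => IsProper.add) isProper_zero h

/-- `deriv` is defined through the reduced fraction; differentiating the cross-multiplied identity
`n b = a d` frees the quotient rule from that choice. -/
lemma deriv_frac {a b : K[X]} (hb : b ≠ 0) :
    deriv (frac a b) = frac (derivative a * b - a * derivative b) (b ^ 2) := by
  set n := (frac a b).num with hn
  set d := (frac a b).denom with hd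
  have hd0 : d ≠ 0 := RatFunc.denom_ne_zero _
  have h : n * b = a * d := num_mul_eq hb
  have h' := congrArg derivative h
  simp only [derivative_mul] at h'
  rw [deriv, ← hn, ← hd, frac_eq_frac_iff (pow_ne_zero 2 hd0) (pow_ne_zero 2 hb)]
  linear_combination b * d * h' - (derivative b * d + b * derivative d) * h

lemma deriv_add (f g : RatFunc K) : deriv (f + g) = deriv f + deriv g := by
  rw [← frac_num_denom f, ← frac_num_denom g]
  have hb := RatFunc.denom_ne_zero f
  have hd := RatFunc.denom_ne_zero g
  rw [frac_add_frac hb hd, deriv_frac hb, deriv_frac hd, deriv_frac (mul_ne_zero hb hd),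
    frac_add_frac (pow_ne_zero 2 hb) (pow_ne_zero 2 hd), mul_pow]
  congr 1
  simp only [derivative_mul, derivative_add]
  ring

lemma deriv_zero : deriv (0 : RatFunc K) = 0 := by simp [deriv]

lemma shift_frac (n : ℤ) (a b : K[X]) :
    shift n (frac a b) = frac (shiftPoly n a) (shiftPoly n b) := by
  simp only [shift, frac, RatFunc.coe_mapRingHom_eq_coe_map]
  exact RatFunc.map_apply_div _ _ _ _

lemma degree_shiftPoly (n : ℤ) (a : K[X]) : (shiftPoly n a).degree = a.degree := by
  simp [shiftPoly]

lemma shiftPoly_ne_zero {n : ℤ} {a : K[X]} (h : a ≠ 0) : shiftPoly n a ≠ 0 := by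
  rwa [← degree_ne_bot, degree_shiftPoly, degree_ne_bot]

lemma IsProper.shift {f : RatFunc K} (hf : IsProper f) (n : ℤ) :
    IsProper (DiscreteResidues.shift n f) := by
  obtain ⟨a, b, hab, rfl⟩ := isProper_iff.1 hf
  rw [shift_frac]
  exact isProper_frac (by simpa only [degree_shiftPoly] using hab)

variable (L : Type*) [Field L] [Algebra K L]

lemma baseChange_frac (a b : K[X]) :
    baseChange L (frac a b) = frac (a.map (algebraMap K L)) (b.map (algebraMap K L)) := by
  simp only [baseChange, frac, RatFunc.coe_mapRingHom_eq_coe_map]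
  exact RatFunc.map_apply_div _ _ _ _

lemma baseChange_injective : Function.Injective (baseChange L : RatFunc K → RatFunc L) :=
  (baseChange L).injective

lemma map_ne_zero_of_ne_zero {b : K[X]} (hb : b ≠ 0) : b.map (algebraMap K L) ≠ 0 :=
  (Polynomial.map_ne_zero_iff (algebraMap K L).injective).2 hb

lemma IsProper.baseChange {f : RatFunc K} (hf : IsProper f) :
    IsProper (DiscreteResidues.baseChange L f) := by
  obtain ⟨a, b, hab, rfl⟩ := isProper_iff.1 hf
  rw [baseChange_frac]
  exact isProper_frac (by simpa only [degree_map] using hab)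

lemma deriv_baseChange (f : RatFunc K) :
    deriv (baseChange L f) = baseChange L (deriv f) := by
  have hb := RatFunc.denom_ne_zero f
  rw [← frac_num_denom f, baseChange_frac, deriv_frac (map_ne_zero_of_ne_zero L hb),
    deriv_frac hb, baseChange_frac]
  simp [derivative_map]

end Frac

/-! ### Laurent expansions and the coefficients of polar parts -/

section Laurent

variable {L : Type*} [Field L]

/-- The Taylor expansion of a polynomial at `α`, as a power series. -/
def powerSeriesAt (α : L) : L[X] →+* PowerSeries L :=
  (Polynomial.coeToPowerSeries.ringHom).comp (taylorAlgHom α : L[X] →+* L[X])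

lemma constantCoeff_powerSeriesAt (α : L) (p : L[X]) :
    PowerSeries.constantCoeff (powerSeriesAt α p) = p.eval α := by
  simp [powerSeriesAt, taylor_coeff_zero]

lemma powerSeriesAt_injective (α : L) : Function.Injective (powerSeriesAt α) := by
  intro p q h
  have : taylor α p = taylor α q := Polynomial.coe_injective L (by simpa [powerSeriesAt] using h)
  exact taylor_injective α this

/-- The expansion of a polynomial at `α`, as a Laurent series. -/
def polyLaurentAt (α : L) : L[X] →+* LaurentSeries L :=
  (HahnSeries.ofPowerSeries ℤ L).comp (powerSeriesAt α)

lemma polyLaurentAt_injective (α : L) : Function.Injective (polyLaurentAt α) :=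
  HahnSeries.ofPowerSeries_injective.comp (powerSeriesAt_injective α)

/-- The Laurent expansion of a rational function at `α`. -/
def laurentAt (α : L) : RatFunc L →+* LaurentSeries L :=
  RatFunc.liftRingHom (polyLaurentAt α)
    (nonZeroDivisors_le_comap_nonZeroDivisors_of_injective _ (polyLaurentAt_injective α))

lemma laurentAt_frac (α : L) (a b : L[X]) :
    laurentAt α (frac a b) = polyLaurentAt α a / polyLaurentAt α b :=
  RatFunc.liftRingHom_apply_div _ _ _ _

lemma polyLaurentAt_X_sub_C_pow (α : L) (e : ℕ) :
    polyLaurentAt α ((X - C α) ^ e) = HahnSeries.single (e : ℤ) 1 := by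
  have : powerSeriesAt α (X - C α) = PowerSeries.X := by
    simp [powerSeriesAt]
  rw [polyLaurentAt, RingHom.comp_apply, map_pow, this, HahnSeries.ofPowerSeries_X_pow]

/-- Since `q(α) ≠ 0`, the quotient `a / q` expands as a power series, so the whole polar part comes
from `(x - α)^(-e)`. This bounds the pole order and gives the leading coefficient. -/
lemma laurentAt_frac_mul (α : L) (a q : L[X]) (e : ℕ) (hq : q.eval α ≠ 0) :
    laurentAt α (frac a ((X - C α) ^ e * q)) = HahnSeries.single (-(e : ℤ)) 1 *
      HahnSeries.ofPowerSeries ℤ L (powerSeriesAt α a * (powerSeriesAt α q)⁻¹) := by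
  have hq0 : q ≠ 0 := by rintro rfl; simp at hq
  have h1 : powerSeriesAt α q * (powerSeriesAt α q)⁻¹ = 1 :=
    PowerSeries.mul_inv_cancel _ (by rwa [constantCoeff_powerSeriesAt])
  have h2 : polyLaurentAt α ((X - C α) ^ e * q) ≠ 0 := by
    rw [Ne, map_eq_zero_iff _ (polyLaurentAt_injective α)]
    exact mul_ne_zero (pow_ne_zero _ (X_sub_C_ne_zero α)) hq0
  rw [laurentAt_frac, div_eq_iff h2, map_mul (polyLaurentAt α), polyLaurentAt_X_sub_C_pow]
  have h3 : (HahnSeries.single (-(e : ℤ)) (1 : L)) * HahnSeries.single (e : ℤ) 1 = 1 := by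
    rw [HahnSeries.single_mul_single]; simp
  have h4 : HahnSeries.ofPowerSeries ℤ L ((powerSeriesAt α q)⁻¹) * polyLaurentAt α q = 1 := by
    rw [polyLaurentAt, RingHom.comp_apply, ← map_mul, mul_comm, h1, map_one]
  rw [map_mul]
  change HahnSeries.ofPowerSeries ℤ L (powerSeriesAt α a) = _
  linear_combination (-HahnSeries.ofPowerSeries ℤ L (powerSeriesAt α a)) * h3 -
    HahnSeries.ofPowerSeries ℤ L (powerSeriesAt α a) * HahnSeries.single (-(e : ℤ)) (1 : L) *
      HahnSeries.single (e : ℤ) 1 * h4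

/-- The coefficient of `(x - α)^(-k)` in the Laurent expansion of `f` at `α`. -/
def polarCoeff (k : ℕ) (α : L) : RatFunc L →+ L where
  toFun f := (laurentAt α f).coeff (-(k : ℤ))
  map_zero' := by simp
  map_add' f g := by simp

lemma polarCoeff_eq_zero {k e : ℕ} (h : e < k) {α : L} (a : L[X]) {q : L[X]}
    (hq : q.eval α ≠ 0) : polarCoeff k α (frac a ((X - C α) ^ e * q)) = 0 := by
  change (laurentAt α _).coeff _ = 0
  have : -(k : ℤ) = ((e : ℤ) - k) + -(e : ℤ) := by ring
  rw [laurentAt_frac_mul α a q e hq, this, HahnSeries.coeff_single_mul_add]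
  rw [PowerSeries.coeff_coe, if_pos (by omega), mul_zero]

lemma polarCoeff_self (e : ℕ) {α : L} (a : L[X]) {q : L[X]} (hq : q.eval α ≠ 0) :
    polarCoeff e α (frac a ((X - C α) ^ e * q)) = a.eval α / q.eval α := by
  change (laurentAt α _).coeff _ = _
  rw [laurentAt_frac_mul α a q e hq]
  nth_rw 2 [← zero_add (-(e : ℤ))]
  rw [HahnSeries.coeff_single_mul_add, PowerSeries.coeff_coe, if_neg (by omega)]
  simp [constantCoeff_powerSeriesAt, div_eq_mul_inv]

lemma polarCoeff_eq_zero_of_eval_ne_zero {k : ℕ} (hk : 0 < k) {α : L} (a : L[X]) {b : L[X]}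
    (hb : b.eval α ≠ 0) : polarCoeff k α (frac a b) = 0 := by
  simpa using polarCoeff_eq_zero hk a hb

lemma polarCoeff_C_mul (k : ℕ) (α v : L) (f : RatFunc L) :
    polarCoeff k α (RatFunc.C v * f) = v * polarCoeff k α f := by
  change (laurentAt α _).coeff _ = _ * (laurentAt α _).coeff _
  have : laurentAt α (RatFunc.C v) = HahnSeries.C v := by
    rw [← RatFunc.algebraMap_C]
    have := laurentAt_frac α (C v) 1
    simp only [frac, map_one, div_one] at this
    rw [this]
    simp [polyLaurentAt, powerSeriesAt]
  rw [map_mul, this, HahnSeries.C_mul_eq_smul, HahnSeries.coeff_smul, smul_eq_mul]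

/-- The sum `∑ c_k(α) / (x - α)^k` attached to a finitely supported family of coefficients. -/
def polarSum (c : ℕ+ × L →₀ L) : RatFunc L :=
  c.sum fun kα v => frac (C v) ((X - C kα.2) ^ (kα.1 : ℕ))

lemma polarSum_single (i : ℕ+ × L) (v : L) :
    polarSum (Finsupp.single i v) = frac (C v) ((X - C i.2) ^ (i.1 : ℕ)) := by
  simp [polarSum]

lemma polarSum_add (c d : ℕ+ × L →₀ L) : polarSum (c + d) = polarSum c + polarSum d :=
  Finsupp.sum_add_index' (by simp) fun i v w => by rw [C_add, frac_add]

open scoped Classical in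
lemma polarCoeff_term {k : ℕ} (hk : 0 < k) (α : L) (j : ℕ) (β v : L) :
    polarCoeff k α (frac (C v) ((X - C β) ^ j)) = if j = k ∧ β = α then v else 0 := by
  by_cases hβ : β = α
  · subst hβ
    have h : laurentAt β (frac (C v) ((X - C β) ^ j)) = HahnSeries.single (-(j : ℤ)) v := by
      rw [← mul_one ((X - C β) ^ j), laurentAt_frac_mul β (C v) 1 j (by simp)]
      have : powerSeriesAt β (C v) * (powerSeriesAt β 1)⁻¹ = PowerSeries.C v := by
        simp [powerSeriesAt]
      rw [this, HahnSeries.ofPowerSeries_C, HahnSeries.C_apply, HahnSeries.single_mul_single]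
      simp
    change (laurentAt β _).coeff _ = _
    rw [h, HahnSeries.coeff_single]
    simp [eq_comm]
  · rw [if_neg (by tauto)]
    refine polarCoeff_eq_zero_of_eval_ne_zero hk _ ?_
    simpa using fun h : α - β = 0 => absurd (sub_eq_zero.1 h).symm hβ

lemma polarCoeff_polarSum (c : ℕ+ × L →₀ L) (k : ℕ+) (α : L) :
    polarCoeff k α (polarSum c) = c (k, α) := by
  classical
  induction c using Finsupp.induction_linear with
  | zero => simp [polarSum]
  | add c d hc hd => rw [polarSum_add, map_add, hc, hd, Finsupp.add_apply]
  | single i v =>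
    rw [polarSum_single, polarCoeff_term k.pos, Finsupp.single_apply]
    simp [Prod.ext_iff]

lemma degree_lt_of_mul_lt {a b c : L[X]} (hc : c ≠ 0) (h : (c * a).degree < (c * b).degree) :
    a.degree < b.degree := by
  by_contra! hle
  by_cases hb : b = 0
  · simp [hb] at h
  by_cases ha : a = 0
  · subst ha
    simp [hb] at hle
  · rw [← natDegree_lt_natDegree_iff (mul_ne_zero hc ha), natDegree_mul hc ha,
      natDegree_mul hc hb] at h
    have := natDegree_le_natDegree hle
    omega

/-- With `b = (x - α)^(j+1) q` and `q(α) ≠ 0`, subtracting `v / (x - α)^(j+1)` for `v = a(α) / q(α)`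
makes the numerator vanish at `α`. One factor `x - α` cancels, and induction on the degree of the
denominator applies. -/
lemma exists_frac_eq_polarSum [IsAlgClosed L] (n : ℕ) : ∀ a b : L[X], b.natDegree = n →
    a.degree < b.degree → ∃ c, frac a b = polarSum c := by
  induction n with
  | zero =>
    intro a b hb hab
    rw [eq_C_of_natDegree_eq_zero hb] at hab
    have : a = 0 := by
      by_contra ha
      have := hab.trans_le degree_C_le
      exact ha (degree_eq_bot.1 (Nat.WithBot.lt_zero_iff.1 this))
    exact ⟨0, by simp [this, polarSum]⟩
  | succ n ih =>
    intro a b hb hab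
    have hb0 := ne_zero_of_degree_lt hab
    have hdeg : b.degree ≠ 0 := fun h => by
      rw [degree_eq_natDegree hb0, hb] at h
      exact absurd (by exact_mod_cast h) n.succ_ne_zero
    obtain ⟨α, hα⟩ := IsAlgClosed.exists_root b hdeg
    obtain ⟨q, hbq, hq⟩ := exists_eq_pow_rootMultiplicity_mul_and_not_dvd b hb0 α
    rw [dvd_iff_isRoot, IsRoot] at hq
    obtain ⟨j, hj⟩ : ∃ j, b.rootMultiplicity α = j + 1 :=
      Nat.exists_eq_succ_of_ne_zero ((rootMultiplicity_pos hb0).2 hα).ne'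
    rw [hj] at hbq
    have hX : X - C α ≠ 0 := X_sub_C_ne_zero α
    have hq0 : q ≠ 0 := by rintro rfl; simp at hq
    set v := a.eval α / q.eval α with hv
    obtain ⟨a', ha'⟩ : X - C α ∣ a - C v * q := by
      rw [dvd_iff_isRoot]
      simp [hv, hq]
    have hbd : b = (X - C α) * ((X - C α) ^ j * q) := by rw [hbq]; ring
    have hqb : q.degree < b.degree := by
      have : (1 : L[X]).degree < ((X - C α) ^ (j + 1)).degree := by
        rw [degree_pow, degree_X_sub_C, degree_one, nsmul_one]
        exact_mod_cast j.succ_pos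
      have := degree_mul_lt this hq0
      rwa [one_mul, ← hbq] at this
    have hdeg' : a'.degree < ((X - C α) ^ j * q).degree := by
      refine degree_lt_of_mul_lt hX ?_
      rw [← ha', ← hbd]
      refine (degree_sub_le _ _).trans_lt (max_lt hab (lt_of_le_of_lt ?_ hqb))
      rw [C_mul']
      exact degree_smul_le v q
    obtain ⟨c, hc⟩ := ih a' ((X - C α) ^ j * q) (by
      rw [hbd, natDegree_mul hX (mul_ne_zero (pow_ne_zero _ hX) hq0), natDegree_X_sub_C] at hb
      omega) hdeg'
    refine ⟨Finsupp.single (⟨j + 1, j.succ_pos⟩, α) v + c, ?_⟩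
    rw [polarSum_add, polarSum_single, ← hc, frac_add_frac (pow_ne_zero _ hX)
      (mul_ne_zero (pow_ne_zero _ hX) hq0), frac_eq_frac_iff hb0
      (mul_ne_zero (pow_ne_zero _ hX) (mul_ne_zero (pow_ne_zero _ hX) hq0)), hbq]
    simp only [PNat.mk_coe]
    rw [sub_eq_iff_eq_add.1 ha']
    ring

lemma IsProper.exists_eq_polarSum [IsAlgClosed L] {f : RatFunc L} (hf : IsProper f) :
    ∃ c, f = polarSum c := by
  obtain ⟨a, b, hab, rfl⟩ := isProper_iff.1 hf
  exact exists_frac_eq_polarSum _ a b rfl hab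

lemma IsProper.eq_of_polarCoeff_eq [IsAlgClosed L] {f g : RatFunc L} (hf : IsProper f)
    (hg : IsProper g) (h : ∀ k : ℕ, 0 < k → ∀ α, polarCoeff k α f = polarCoeff k α g) :
    f = g := by
  obtain ⟨c, rfl⟩ := hf.exists_eq_polarSum
  obtain ⟨d, rfl⟩ := hg.exists_eq_polarSum
  congr 1
  ext ⟨k, α⟩
  rw [← polarCoeff_polarSum c, ← polarCoeff_polarSum d, h k k.pos]

lemma IsProper.polarCoeff_deriv [IsAlgClosed L] {f : RatFunc L} (hf : IsProper f)
    (k : ℕ) (α : L) : polarCoeff (k + 1) α (deriv f) = -(k * polarCoeff k α f) := by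
  obtain ⟨c, rfl⟩ := hf.exists_eq_polarSum
  clear hf
  induction c using Finsupp.induction_linear with
  | zero => simp [polarSum, deriv_zero]
  | add c d hc hd => rw [polarSum_add, deriv_add, map_add, hc, hd, map_add]; ring
  | single i v =>
    obtain ⟨j, β⟩ := i
    have hX : X - C β ≠ 0 := X_sub_C_ne_zero β
    have : deriv (frac (C v) ((X - C β) ^ (j : ℕ))) =
        frac (C (-(j * v))) ((X - C β) ^ ((j : ℕ) + 1)) := by
      rw [deriv_frac (pow_ne_zero _ hX), frac_eq_frac_iff (pow_ne_zero _ (pow_ne_zero _ hX))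
        (pow_ne_zero _ hX)]
      obtain ⟨m, hm⟩ := Nat.exists_eq_succ_of_ne_zero j.ne_zero
      rw [hm]
      simp [derivative_X_sub_C_pow]
      ring
    rw [polarSum_single, this, polarCoeff_term k.succ_pos]
    -- For `k = 0` the left side vanishes because `j ≥ 1`: differentiating `(x - β)^(-j)` never
    -- produces a simple pole.
    rcases k.eq_zero_or_pos with rfl | hk
    · simp
    · rw [polarCoeff_term hk]
      by_cases h : (j : ℕ) = k ∧ β = α
      · simp [h.1, h.2]
      · rw [if_neg (by simpa using h), if_neg h, mul_zero, neg_zero]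

lemma finite_setOf_polarCoeff_ne_zero {k : ℕ} (hk : 0 < k) (f : RatFunc L) :
    {α | polarCoeff k α f ≠ 0}.Finite := by
  refine Set.Finite.subset (f.denom.rootSet_finite L) fun α hα => ?_
  rw [mem_rootSet_of_ne (RatFunc.denom_ne_zero f)]
  by_contra h
  rw [Set.mem_ofPred_eq, ← frac_num_denom f] at hα
  exact hα (polarCoeff_eq_zero_of_eval_ne_zero hk _ (by simpa using h))

/-- At a pole of exact order `e` the coefficient of order `e` is `num(α) / q(α)`, which is nonzero
because the fraction is reduced. -/
lemma rootMultiplicity_denom_le {f : RatFunc L} {α : L} {m : ℕ}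
    (h : ∀ k, m < k → polarCoeff k α f = 0) : f.denom.rootMultiplicity α ≤ m := by
  by_contra! hlt
  have hd := RatFunc.denom_ne_zero f
  obtain ⟨q, hbq, hq⟩ := exists_eq_pow_rootMultiplicity_mul_and_not_dvd f.denom hd α
  rw [dvd_iff_isRoot, IsRoot] at hq
  have h1 := h _ hlt
  have hroot : f.denom.eval α = 0 := (rootMultiplicity_pos hd).1 (by omega)
  have h2 : polarCoeff (f.denom.rootMultiplicity α) α f = f.num.eval α / q.eval α := by
    have := polarCoeff_self (f.denom.rootMultiplicity α) f.num hq
    rwa [← hbq, frac_num_denom] at this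
  obtain ⟨u, v, huv⟩ := RatFunc.isCoprime_num_denom f
  have h3 : f.num.eval α = 0 := by
    have := h2.symm.trans h1
    simpa [hq] using this
  simpa [h3, hroot] using congrArg (eval α) huv

lemma polarCoeff_eq_zero_of_squarefree {a b : L[X]} (hb : IsSquarefreePoly b) {k : ℕ} (hk : 1 < k)
    (α : L) : polarCoeff k α (frac a b) = 0 := by
  obtain ⟨hb0, u, v, huv⟩ := hb
  by_cases hα : b.eval α = 0
  · obtain ⟨q, rfl⟩ := dvd_iff_isRoot.2 hα
    rw [← pow_one (X - C α)]
    refine polarCoeff_eq_zero hk a fun hq => ?_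
    simpa [hq] using congrArg (eval α) huv
  · exact polarCoeff_eq_zero_of_eval_ne_zero (by omega) a hα

lemma polarCoeff_one_eq {a b : L[X]} {α : L} (hb : b.eval α = 0)
    (hb' : (derivative b).eval α ≠ 0) :
    polarCoeff 1 α (frac a b) = a.eval α / (derivative b).eval α := by
  obtain ⟨q, rfl⟩ := dvd_iff_isRoot.2 hb
  have h : (derivative ((X - C α) * q)).eval α = q.eval α := by simp
  rw [h] at hb' ⊢
  simpa using polarCoeff_self 1 a hb'

end Laurent

/-! ### Hermite reduction -/

section Hermite

variable {K : Type*} [Field K]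

lemma IsSquarefreePoly.of_dvd {a b : K[X]} (hb : IsSquarefreePoly b) (h : a ∣ b) :
    IsSquarefreePoly a :=
  ⟨ne_zero_of_dvd_ne_zero hb.1 h, Separable.of_dvd hb.2 h⟩

lemma IsSquarefreePoly.map {b : K[X]} (hb : IsSquarefreePoly b) (L : Type*) [Field L]
    [Algebra K L] : IsSquarefreePoly (b.map (algebraMap K L)) :=
  ⟨map_ne_zero_of_ne_zero L hb.1, Separable.map hb.2⟩

lemma degree_mul_left_lt {a b c : K[X]} (h : a.degree < b.degree) (hc : c ≠ 0) :
    (c * a).degree < (c * b).degree := by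
  rw [mul_comm c a, mul_comm c b]
  exact degree_mul_lt h hc

lemma degree_C_mul_le (c : K) (p : K[X]) : (C c * p).degree ≤ p.degree := by
  rw [C_mul']
  exact degree_smul_le c p

/-- From a Bézout relation `u q + v q' = 1`, with `t` the remainder of `a v` modulo `q`. Both the
Hermite step and `FirstResidues` rest on this. -/
lemma exists_mul_derivative_add {q : K[X]} (hq : IsSquarefreePoly q) (a : K[X]) :
    ∃ t s : K[X], t.degree < q.degree ∧ a = t * derivative q + q * s := by
  obtain ⟨hq0, u, v, huv⟩ := hq
  refine ⟨(a * v) % q, a * u + (a * v) / q * derivative q, degree_mod_lt _ hq0, ?_⟩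
  have h := EuclideanDomain.div_add_mod (a * v) q
  linear_combination (-a) * huv - derivative q * h

/-- Integration by parts. Write `a = t q' + q s` and `c = -1/(n+1)`. Then `a / q^(n+2)` is the
derivative of `c t / q^(n+1)` plus `(s - c t') / q^(n+1)`, whose exponent is one lower. Iterating
leaves a function with denominator `q`. -/
lemma exists_hermite_step [CharZero K] {q : K[X]} (hq : IsSquarefreePoly q) (n : ℕ) :
    ∀ a : K[X], a.degree < (q ^ (n + 1)).degree →
      ∃ t s : K[X], t.degree < (q ^ n).degree ∧ s.degree < q.degree ∧
        frac a (q ^ (n + 1)) = deriv (frac t (q ^ n)) + frac s q := by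
  have hq0 := hq.1
  induction n with
  | zero =>
    intro a ha
    refine ⟨0, a, by simp, by simpa using ha, by simp [deriv_zero]⟩
  | succ n ih =>
    intro a ha
    obtain ⟨t, s, ht, rfl⟩ := exists_mul_derivative_add hq a
    have hle : q.degree ≤ (q ^ (n + 1)).degree :=
      degree_le_of_dvd (dvd_pow_self q n.succ_ne_zero) (pow_ne_zero _ hq0)
    have ht' : (t * derivative q).degree < (q ^ (n + 1 + 1)).degree := by
      refine lt_of_lt_of_le ?_ (degree_le_of_dvd (p := q * q) ?_ (pow_ne_zero _ hq0))
      · by_cases hd : derivative q = 0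
        · rw [hd, mul_zero, degree_zero, bot_lt_iff_ne_bot, degree_ne_bot]
          exact mul_ne_zero hq0 hq0
        · refine (degree_mul_lt ht hd).trans_le ?_
          rw [degree_mul, degree_mul]
          gcongr
          exact degree_derivative_le
      · rw [← sq]
        exact pow_dvd_pow q (by omega)
    have hs : s.degree < (q ^ (n + 1)).degree := by
      refine degree_lt_of_mul_lt hq0 ?_
      rw [← pow_succ']
      have : q * s = (t * derivative q + q * s) - t * derivative q := by ring
      rw [this]
      exact (degree_sub_le _ _).trans_lt (max_lt ha ht')
    set c : K := -((n : K) + 1)⁻¹ with hc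
    have hn : ((n : K) + 1) ≠ 0 := by exact_mod_cast n.succ_ne_zero
    obtain ⟨t₂, s₂, ht₂, hs₂, h₂⟩ := ih (s - C c * derivative t) (by
      refine (degree_sub_le _ _).trans_lt (max_lt hs ?_)
      exact (degree_C_mul_le _ _).trans_lt
        (degree_derivative_le.trans_lt (ht.trans_le hle)))
    refine ⟨C c * t + q * t₂, s₂, ?_, hs₂, ?_⟩
    · refine (degree_add_le _ _).trans_lt (max_lt ?_ ?_)
      · exact (degree_C_mul_le _ _).trans_lt (ht.trans_le hle)
      · rw [pow_succ']
        exact degree_mul_left_lt ht₂ hq0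
    · have e1 : frac (q * t₂) (q ^ (n + 1)) = frac t₂ (q ^ n) := by
        rw [pow_succ, mul_comm q t₂, frac_mul_mul_right hq0]
      rw [frac_add (C c * t), deriv_add, e1, add_assoc (deriv _), ← h₂,
        deriv_frac (pow_ne_zero _ hq0),
        frac_add_frac (pow_ne_zero _ (pow_ne_zero _ hq0)) (pow_ne_zero _ hq0),
        frac_eq_frac_iff (pow_ne_zero _ hq0) (mul_ne_zero (pow_ne_zero _ (pow_ne_zero _ hq0))
          (pow_ne_zero _ hq0))]
      have hC : C c * ((n : K[X]) + 1) = -1 := by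
        rw [← C_eq_natCast, ← C_1, ← C_add, ← C_mul, ← C_neg, hc]
        congr 1
        field_simp
      simp only [derivative_mul, derivative_C, derivative_pow, zero_mul, zero_add,
        Nat.cast_add, Nat.cast_one, add_tsub_cancel_right, C_add, C_1, C_eq_natCast]
      linear_combination (t * derivative q * q ^ (3 * n + 3)) * hC

lemma exists_hermiteLoop_frac [CharZero K] {q : K[X]} (hq : IsSquarefreePoly q) (n : ℕ) :
    ∀ a : K[X], a.degree < (q ^ n).degree → ∃ l, HermiteLoop (frac a (q ^ n)) l := by
  induction n with
  | zero =>
    intro a ha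
    have : a = 0 := by
      rw [pow_zero, degree_one] at ha
      exact degree_eq_bot.1 (Nat.WithBot.lt_zero_iff.1 ha)
    exact ⟨[], by simpa [this] using HermiteLoop.done⟩
  | succ n ih =>
    intro a ha
    by_cases h0 : frac a (q ^ (n + 1)) = 0
    · exact ⟨[], h0 ▸ HermiteLoop.done⟩
    obtain ⟨t, s, ht, hs, h⟩ := exists_hermite_step hq n a ha
    obtain ⟨l, hl⟩ := ih t ht
    exact ⟨_, HermiteLoop.step h0 ⟨isProper_frac ha, isProper_frac ht, isProper_frac hs, h,
      hq.of_dvd (denom_frac_dvd _ _)⟩ hl⟩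

lemma exists_hermiteLoop [CharZero K] {f : RatFunc K} (hf : IsProper f) :
    ∃ l, HermiteLoop f l := by
  classical
  have hd := RatFunc.denom_ne_zero f
  -- The radical is squarefree and one of its powers is a multiple of the denominator. The fraction
  -- over that power need not be reduced; only the decreasing exponent matters.
  set q := UniqueFactorizationMonoid.radical f.denom with hq
  obtain ⟨n, c, hc⟩ := UniqueFactorizationMonoid.exists_dvd_radical_self_pow hd
  have hsq : IsSquarefreePoly q :=
    ⟨UniqueFactorizationMonoid.radical_ne_zero,
      PerfectField.separable_iff_squarefree.2 UniqueFactorizationMonoid.squarefree_radical⟩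
  have hc0 : c ≠ 0 := by
    rintro rfl
    rw [mul_zero] at hc
    exact pow_ne_zero n hsq.1 hc
  obtain ⟨l, hl⟩ := exists_hermiteLoop_frac hsq n (f.num * c) (by
    rw [hq, hc]
    exact degree_mul_lt hf hc0)
  rw [hq, hc, frac_mul_mul_right hc0, frac_num_denom] at hl
  exact ⟨l, hl⟩

lemma HermiteLoop.isProper_and_squarefree {f : RatFunc K} {l : List (RatFunc K)}
    (h : HermiteLoop f l) : ∀ g ∈ l, IsProper g ∧ IsSquarefreePoly g.denom := by
  induction h with
  | done => simp
  | step _ hr _ ih =>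
    intro g hg
    rcases List.mem_cons.1 hg with rfl | hg
    · exact ⟨hr.proper_snd, hr.squarefree⟩
    · exact ih g hg

variable (L : Type*) [Field L] [Algebra K L]

lemma polarCoeff_baseChange_of_squarefree {f : RatFunc K} (hf : IsSquarefreePoly f.denom)
    {k : ℕ} (hk : 1 < k) (α : L) : polarCoeff k α (baseChange L f) = 0 := by
  rw [← frac_num_denom f, baseChange_frac]
  exact polarCoeff_eq_zero_of_squarefree (hf.map L) hk α

variable [IsAlgClosed L]

lemma HermiteReduction.polarCoeff_one {f g h : RatFunc K} (H : HermiteReduction f g h) (α : L) :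
    polarCoeff 1 α (baseChange L f) = polarCoeff 1 α (baseChange L h) := by
  have := (H.proper_fst.baseChange L).polarCoeff_deriv 0 α
  rw [H.eq, map_add, map_add, ← deriv_baseChange, this]
  simp

lemma HermiteReduction.polarCoeff_succ {f g h : RatFunc K} (H : HermiteReduction f g h) {k : ℕ}
    (hk : 0 < k) (α : L) :
    polarCoeff (k + 1) α (baseChange L f) = -(k * polarCoeff k α (baseChange L g)) := by
  rw [H.eq, map_add, map_add, ← deriv_baseChange, (H.proper_fst.baseChange L).polarCoeff_deriv,
    polarCoeff_baseChange_of_squarefree L H.squarefree (by omega), add_zero]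

/-- The factors `-1, -2, …, -i` picked up by successive derivatives give `(-1)^i i!`. The default
`0` in `getD` records that the loop stops at `g = 0`, so coefficients of order above the length of
the list vanish. -/
lemma HermiteLoop.polarCoeff_eq {f : RatFunc K} {l : List (RatFunc K)} (H : HermiteLoop f l)
    (i : ℕ) (α : L) : polarCoeff (i + 1) α (baseChange L f) =
      (-1) ^ i * (i.factorial : L) * polarCoeff 1 α (baseChange L (l.getD i 0)) := by
  induction H generalizing i with
  | done => simp
  | step h0 hr _ ih =>
    cases i with
    | zero => simpa using hr.polarCoeff_one L α
    | succ i =>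
      rw [hr.polarCoeff_succ L i.succ_pos, ih, Nat.factorial_succ, List.getD_cons_succ]
      push_cast
      ring

/-- The coefficient of order `k` of `g` is recovered from that of order `k + 1` of `f` because `-k`
is invertible. The function `h` has only first-order coefficients, and they are those of `f`. -/
lemma HermiteReduction.unique [CharZero K] {f g h g' h' : RatFunc K}
    (H : HermiteReduction f g h) (H' : HermiteReduction f g' h') : g = g' ∧ h = h' := by
  let L := AlgebraicClosure K
  constructor
  · apply baseChange_injective L
    refine (H.proper_fst.baseChange L).eq_of_polarCoeff_eq (H'.proper_fst.baseChange L)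
      fun k hk α => ?_
    have h1 := H.polarCoeff_succ L hk α
    rw [H'.polarCoeff_succ L hk α, neg_inj] at h1
    exact (mul_left_cancel₀ (Nat.cast_ne_zero.2 hk.ne') h1).symm
  · apply baseChange_injective L
    refine (H.proper_snd.baseChange L).eq_of_polarCoeff_eq (H'.proper_snd.baseChange L)
      fun k hk α => ?_
    rcases Nat.lt_or_eq_of_le hk with hk | rfl
    · rw [polarCoeff_baseChange_of_squarefree L H.squarefree (by omega),
        polarCoeff_baseChange_of_squarefree L H'.squarefree (by omega)]
    · exact (H.polarCoeff_one L α).symm.trans (H'.polarCoeff_one L α)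

lemma HermiteLoop.unique [CharZero K] {f : RatFunc K} {l l' : List (RatFunc K)}
    (H : HermiteLoop f l) (H' : HermiteLoop f l') : l = l' := by
  induction H generalizing l' with
  | done =>
    cases H' with
    | done => rfl
    | step h => exact absurd rfl h
  | step h0 hr _ ih =>
    cases H' with
    | done => exact absurd rfl h0
    | step _ hr' hl' =>
      obtain ⟨rfl, rfl⟩ := hr.unique hr'
      rw [ih hl']

end Hermite

/-! ### Monic greatest common divisors and least common multiples -/

section GcdLcm

attribute [local instance] UniqueFactorizationMonoid.toNormalizedGCDMonoid

variable {K : Type*} [Field K]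

lemma polyGcd_dvd_left (p q : K[X]) : polyGcd p q ∣ p := by
  classical exact gcd_dvd_left p q

lemma polyGcd_dvd_right (p q : K[X]) : polyGcd p q ∣ q := by
  classical exact gcd_dvd_right p q

lemma dvd_polyGcd {p q r : K[X]} (hp : r ∣ p) (hq : r ∣ q) : r ∣ polyGcd p q := by
  classical exact dvd_gcd hp hq

lemma polyGcd_ne_zero {p q : K[X]} (h : p ≠ 0) : polyGcd p q ≠ 0 :=
  ne_zero_of_dvd_ne_zero h (polyGcd_dvd_left p q)

lemma monic_of_normalize_eq [DecidableEq K] {p : K[X]} (h : normalize p = p) (hp : p ≠ 0) :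
    p.Monic :=
  h ▸ monic_normalize hp

lemma monic_polyGcd {p q : K[X]} (h : p ≠ 0) : (polyGcd p q).Monic := by
  classical
  refine monic_of_normalize_eq ?_ (polyGcd_ne_zero h)
  unfold polyGcd
  convert normalize_gcd p q

/-- The Euclidean gcd divides the normalized one, so its Bézout relation transfers. Hence roots of
gcd's are common roots. -/
lemma exists_polyGcd_eq (p q : K[X]) : ∃ u v, polyGcd p q = u * p + v * q := by
  classical
  obtain ⟨w, hw⟩ : EuclideanDomain.gcd p q ∣ polyGcd p q :=
    dvd_polyGcd (EuclideanDomain.gcd_dvd_left p q) (EuclideanDomain.gcd_dvd_right p q)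
  refine ⟨EuclideanDomain.gcdA p q * w, EuclideanDomain.gcdB p q * w, ?_⟩
  rw [hw, EuclideanDomain.gcd_eq_gcd_ab]
  ring

lemma dvd_polyLcm {S : Finset ℕ} (p : ℕ → K[X]) {i : ℕ} (hi : i ∈ S) : p i ∣ polyLcm S p := by
  classical exact Finset.dvd_lcm hi

lemma polyLcm_dvd {S : Finset ℕ} {p : ℕ → K[X]} {q : K[X]} (h : ∀ i ∈ S, p i ∣ q) :
    polyLcm S p ∣ q := by
  classical exact Finset.lcm_dvd h

lemma monic_polyLcm {S : Finset ℕ} {p : ℕ → K[X]} (h : polyLcm S p ≠ 0) :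
    (polyLcm S p).Monic := by
  classical
  refine monic_of_normalize_eq ?_ h
  unfold polyLcm
  convert Finset.normalize_lcm (s := S) (f := p)

variable {L : Type*} [Field L] [Algebra K L]

lemma aeval_eq_zero_of_dvd {p q : K[X]} (h : p ∣ q) {α : L} (hp : aeval α p = 0) :
    aeval α q = 0 := by
  obtain ⟨r, rfl⟩ := h
  simp [hp]

lemma aeval_polyGcd_eq_zero_iff (p q : K[X]) (α : L) :
    aeval α (polyGcd p q) = 0 ↔ aeval α p = 0 ∧ aeval α q = 0 := by
  refine ⟨fun h => ⟨aeval_eq_zero_of_dvd (polyGcd_dvd_left p q) h,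
    aeval_eq_zero_of_dvd (polyGcd_dvd_right p q) h⟩, fun ⟨hp, hq⟩ => ?_⟩
  obtain ⟨u, v, huv⟩ := exists_polyGcd_eq p q
  simp [huv, hp, hq]

lemma aeval_polyLcm_eq_zero_iff (S : Finset ℕ) (p : ℕ → K[X]) (α : L) :
    aeval α (polyLcm S p) = 0 ↔ ∃ i ∈ S, aeval α (p i) = 0 := by
  refine ⟨fun h => ?_, fun ⟨i, hi, h⟩ => aeval_eq_zero_of_dvd (dvd_polyLcm p hi) h⟩
  have := aeval_eq_zero_of_dvd (polyLcm_dvd fun i hi => Finset.dvd_prod_of_mem p hi) h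
  rwa [map_prod, Finset.prod_eq_zero_iff] at this

lemma isCoprime_of_aeval (L : Type*) [Field L] [Algebra K L] [IsAlgClosed L] {p q : K[X]}
    (h : ∀ α : L, aeval α p = 0 → aeval α q ≠ 0) : IsCoprime p q := by
  refine isCoprime_of_dvd _ _ (fun h0 => h 0 (by simp [h0.1]) (by simp [h0.2]))
    fun d hd hd0 hp hq => ?_
  obtain ⟨α, hα⟩ := IsAlgClosed.exists_aeval_eq_zero L d
    (degree_pos_of_ne_zero_of_nonunit hd0 hd).ne'
  exact h α (aeval_eq_zero_of_dvd hp hα) (aeval_eq_zero_of_dvd hq hα)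

lemma aeval_ne_zero_of_isCoprime {p q : K[X]} (h : IsCoprime p q) {α : L} (hp : aeval α p = 0) :
    aeval α q ≠ 0 := by
  obtain ⟨u, v, huv⟩ := h
  intro hq
  simpa [hp, hq] using congrArg (aeval α) huv

lemma IsSquarefreePoly.aeval_derivative_ne_zero {b : K[X]} (hb : IsSquarefreePoly b) {α : L}
    (h : aeval α b = 0) : aeval α (derivative b) ≠ 0 :=
  aeval_ne_zero_of_isCoprime hb.2 h

lemma IsSquarefreePoly.aeval_ne_zero_of_mul {p q : K[X]} (hb : IsSquarefreePoly (p * q)) {α : L}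
    (h : aeval α p = 0) : aeval α q ≠ 0 := fun h' =>
  hb.aeval_derivative_ne_zero (α := α) (by simp [h]) (by simp [h, h'])

/-- The cofactor `c` in `b = gcd(b, p) c` has no root: such a root is also a root of the gcd, hence
a double root of `b`. -/
lemma IsSquarefreePoly.dvd_of_aeval (L : Type*) [Field L] [Algebra K L] [IsAlgClosed L]
    {b p : K[X]} (hb : IsSquarefreePoly b)
    (h : ∀ α : L, aeval α b = 0 → aeval α p = 0) : b ∣ p := by
  obtain ⟨c, hc⟩ := polyGcd_dvd_left b p
  have hu : IsCoprime b c := by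
    refine isCoprime_of_aeval L fun α hα => ?_
    have h1 := (aeval_polyGcd_eq_zero_iff b p α).2 ⟨hα, h α hα⟩
    rw [hc] at hb
    exact hb.aeval_ne_zero_of_mul h1
  have hcu : IsUnit c := hu.isUnit_of_dvd' (hc ▸ dvd_mul_left c _) dvd_rfl
  have : b ∣ polyGcd b p := by
    conv_lhs => rw [hc]
    exact hcu.mul_right_dvd.2 dvd_rfl
  exact this.trans (polyGcd_dvd_right b p)

end GcdLcm

/-! ### The shift set -/

section ShiftSet

variable {K : Type*} [Field K] {L : Type*} [Field L] [Algebra K L]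

lemma aeval_shiftPoly (n : ℤ) (b : K[X]) (α : L) :
    aeval α (shiftPoly n b) = aeval (α + n) b := by
  simp [shiftPoly, taylor_apply, aeval_comp]

lemma aeval_shiftResultant_eq_zero_iff [IsAlgClosed L] {b : K[X]} (hb : b ≠ 0) (z : L) :
    aeval z (shiftResultant b) = 0 ↔ ∃ α : L, aeval α b = 0 ∧ aeval (α + z) b = 0 := by
  have hC : Function.Injective (C : K → K[X]) := C_injective
  set φ : K[X] →+* L := (aeval z : K[X] →ₐ[K] L).toRingHom with hφ
  have h1 : (b.map C).map φ = b.map (algebraMap K L) := by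
    rw [map_map]
    congr 1
    ext x
    simp [φ]
  have h2 : (taylor (X : K[X]) (b.map C)).map φ = taylor z (b.map (algebraMap K L)) := by
    rw [taylor_apply, taylor_apply, map_comp, h1]
    simp [φ]
  have h3 : φ (shiftResultant b) =
      resultant (b.map (algebraMap K L)) (taylor z (b.map (algebraMap K L))) := by
    -- Specializing `z` commutes with the resultant because the degrees in `x` of both polynomials
    -- are preserved.
    rw [shiftResultant, ← resultant_map_map, h1, h2]
    simp [natDegree_map_eq_of_injective hC, natDegree_map]
  change φ (shiftResultant b) = 0 ↔ _
  rw [h3, resultant_eq_zero_iff]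
  have h4 : ∀ α : L, aeval α (taylor z (b.map (algebraMap K L))) = aeval (α + z) b := fun α => by
    simp [taylor_apply, aeval_comp]
  have h5 : ∀ α : L, aeval α (b.map (algebraMap K L)) = aeval α b := fun α => by simp
  constructor
  · rintro ⟨-, hn⟩
    by_contra! hne
    refine hn (isCoprime_of_aeval L fun α hα => ?_)
    rw [h4]
    exact hne α (by rwa [h5] at hα)
  · rintro ⟨α, hα, hαz⟩
    refine ⟨Or.inl (map_ne_zero_of_ne_zero L hb), fun hc => ?_⟩
    exact aeval_ne_zero_of_isCoprime hc (α := α) (by rw [h5, hα]) (by rw [h4, hαz])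

lemma finite_aeval_eq_zero {b : K[X]} (hb : b ≠ 0) : {α : L | aeval α b = 0}.Finite := by
  convert b.rootSet_finite L using 1
  ext α
  simp [mem_rootSet_of_ne hb]

/-- Zeros of the resultant are differences of the finitely many roots of `b`, while an algebraically
closed field is infinite. -/
lemma shiftResultant_ne_zero [CharZero K] {b : K[X]} (hb : b ≠ 0) : shiftResultant b ≠ 0 := by
  intro h
  let L := AlgebraicClosure K
  have hfin := finite_aeval_eq_zero (L := L) hb
  have h1 : (Set.univ : Set L) ⊆ Set.image2 (fun α β => β - α) {α : L | aeval α b = 0}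
      {α : L | aeval α b = 0} := by
    intro z _
    obtain ⟨α, hα, hαz⟩ := (aeval_shiftResultant_eq_zero_iff hb z).1 (by simp [h])
    exact ⟨α, hα, α + z, hαz, by simp⟩
  exact Set.infinite_univ ((hfin.image2 _ hfin).subset h1)

/-- In characteristic zero a root of multiplicity `e` of `R` has multiplicity `e - 1` in `R'`, hence
in the gcd, and so multiplicity 1 in `Q`. -/
lemma exists_eq_polyGcd_derivative_mul (L : Type*) [Field L] [Algebra K L]
    [IsAlgClosed L] [CharZero L] {R : K[X]} (hR : R ≠ 0) :
    ∃ Q, R = polyGcd R (derivative R) * Q ∧ IsSquarefreePoly Q ∧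
      ∀ z : L, aeval z Q = 0 ↔ aeval z R = 0 := by
  obtain ⟨Q, hQ⟩ := polyGcd_dvd_left R (derivative R)
  have hQ0 : Q ≠ 0 := by
    rintro rfl
    exact hR (by rw [hQ, mul_zero])
  have key : ∀ z : L, aeval z R = 0 →
      (Q.map (algebraMap K L)).rootMultiplicity z = 1 := by
    intro z hz
    set P := R.map (algebraMap K L) with hP
    set G := (polyGcd R (derivative R)).map (algebraMap K L) with hG
    have hP0 : P ≠ 0 := map_ne_zero_of_ne_zero L hR
    have hroot : P.IsRoot z := by rw [IsRoot, hP, eval_map_algebraMap, hz]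
    have hPQ : P = G * Q.map (algebraMap K L) := by
      rw [hP, hG, ← Polynomial.map_mul, ← hQ]
    have hm := (rootMultiplicity_pos hP0).2 hroot
    have hd := derivative_rootMultiplicity_of_root hroot
    have hd0 : derivative P ≠ 0 := by
      intro h0
      have := derivative_eq_zero.1 h0
      rw [eq_C_of_natDegree_eq_zero this] at hroot hP0
      exact hP0 (by rw [IsRoot, eval_C] at hroot; rw [hroot, C_0])
    have hG0 : G ≠ 0 := map_ne_zero_of_ne_zero L (polyGcd_ne_zero hR)
    have hle : G.rootMultiplicity z ≤ (derivative P).rootMultiplicity z := by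
      refine rootMultiplicity_le_rootMultiplicity_of_dvd hd0 ?_ z
      rw [hP, derivative_map]
      exact Polynomial.map_dvd _ (polyGcd_dvd_right _ _)
    have hge : P.rootMultiplicity z - 1 ≤ G.rootMultiplicity z := by
      rw [le_rootMultiplicity_iff hG0]
      obtain ⟨u, v, huv⟩ := exists_polyGcd_eq R (derivative R)
      rw [hG, huv, Polynomial.map_add, Polynomial.map_mul, Polynomial.map_mul, ← derivative_map,
        ← hP]
      refine dvd_add (Dvd.dvd.mul_left ?_ _) (Dvd.dvd.mul_left ?_ _)
      · exact (pow_dvd_pow _ (Nat.sub_le _ 1)).trans (pow_rootMultiplicity_dvd P z)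
      · rw [← hd]
        exact pow_rootMultiplicity_dvd _ z
    have hmul := rootMultiplicity_mul (x := z) (hPQ ▸ hP0)
    rw [← hPQ] at hmul
    omega
  have hiff : ∀ z : L,
      aeval z Q = 0 ↔ aeval z R = 0 := by
    intro z
    refine ⟨fun h => by rw [hQ, map_mul, h, mul_zero], fun h => ?_⟩
    have := (rootMultiplicity_pos (map_ne_zero_of_ne_zero L hQ0)).1
      (by rw [key z h]; exact one_pos)
    rwa [IsRoot, eval_map_algebraMap] at this
  refine ⟨Q, hQ, ⟨hQ0, ?_⟩, hiff⟩
  refine isCoprime_of_aeval L fun z hz hz' => ?_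
  have h1 := key z ((hiff z).1 hz)
  have h2 := (one_lt_rootMultiplicity_iff_isRoot
    (map_ne_zero_of_ne_zero L hQ0) (t := z)).2
    ⟨by rw [IsRoot, eval_map_algebraMap, hz],
      by rw [IsRoot, derivative_map, eval_map_algebraMap, hz']⟩
  omega

lemma exists_reducedShiftResultant_spec (L : Type*) [Field L] [Algebra K L] [IsAlgClosed L]
    [CharZero K] {b : K[X]} (hb : 0 < b.natDegree) :
    IsSquarefreePoly (reducedShiftResultant b) ∧ ∀ z : L,
      aeval z (reducedShiftResultant b) = 0 ↔
        z ≠ 0 ∧ ∃ α : L, aeval α b = 0 ∧ aeval (α + z) b = 0 := by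
  have hL : CharZero L := charZero_of_injective_algebraMap (algebraMap K L).injective
  have hb0 : b ≠ 0 := by rintro rfl; simp at hb
  have hR := shiftResultant_ne_zero hb0
  obtain ⟨Q, hQ, hsq, hiff⟩ := exists_eq_polyGcd_derivative_mul L hR
  have hG := polyGcd_ne_zero (q := derivative (shiftResultant b)) hR
  -- The zero difference `α - α` always occurs; as `Q` is squarefree, dividing by `X` removes the
  -- root `0` completely.
  have hX : X ∣ Q := by
    obtain ⟨α, hα⟩ := IsAlgClosed.exists_aeval_eq_zero L b (natDegree_pos_iff_degree_pos.1 hb).ne'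
    have h0 := (hiff 0).2 ((aeval_shiftResultant_eq_zero_iff hb0 0).2 ⟨α, hα, by simpa using hα⟩)
    rw [X_dvd_iff, coeff_zero_eq_eval_zero]
    have : aeval (algebraMap K L 0) Q = 0 := by simpa using h0
    rw [aeval_algebraMap_apply] at this
    simpa using this
  obtain ⟨P, rfl⟩ := hX
  have hP : reducedShiftResultant b = P := by
    rw [reducedShiftResultant]
    nth_rw 1 [hQ]
    rw [← mul_assoc, mul_comm X]
    exact mul_div_cancel_left₀ P (mul_ne_zero hG X_ne_zero)
  rw [hP]
  refine ⟨hsq.of_dvd (dvd_mul_left P X), fun z => ?_⟩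
  rw [← aeval_shiftResultant_eq_zero_iff hb0, ← hiff, map_mul, aeval_X, mul_eq_zero]
  constructor
  · intro hz
    refine ⟨?_, Or.inr hz⟩
    rintro rfl
    exact hsq.aeval_ne_zero_of_mul (α := (0 : L)) (by simp) hz
  · rintro ⟨h0, h | h⟩
    · exact absurd h h0
    · exact h

/-- Symmetry of the roots makes `P` divide `P(-x)`, of equal degree, so the quotient is constant.
Comparing values at `0` shows it is `1`; `P = x` shows why `P(0) ≠ 0` is required. -/
lemma comp_neg_X_eq_self (L : Type*) [Field L] [Algebra K L] [IsAlgClosed L] {P : K[X]}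
    (hP : IsSquarefreePoly P) (h0 : P.eval 0 ≠ 0)
    (h : ∀ z : L, aeval z P = 0 → aeval (-z) P = 0) : P.comp (-X) = P := by
  obtain ⟨c, hc⟩ : P ∣ P.comp (-X) :=
    hP.dvd_of_aeval L fun z hz => by simpa [aeval_comp] using h z hz
  have hc0 : c ≠ 0 := by
    rintro rfl
    rw [mul_zero, comp_neg_X_eq_zero_iff] at hc
    exact hP.1 hc
  have hdeg : c.natDegree = 0 := by
    have := congrArg natDegree hc
    rw [natDegree_mul hP.1 hc0, natDegree_comp, natDegree_neg, natDegree_X] at this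
    omega
  have hev := congrArg (eval 0) hc
  rw [eq_C_of_natDegree_eq_zero hdeg] at hev hc
  simp only [eval_comp, eval_neg, eval_X, neg_zero, eval_mul, eval_C] at hev
  have : c.coeff 0 = 1 := mul_left_cancel₀ h0 (by rw [← hev, mul_one])
  rw [hc, this, C_1, mul_one]

lemma expand_contract_two [CharZero K] {P : K[X]} (h : P.comp (-X) = P) :
    expand K 2 (contract 2 P) = P := by
  ext n
  rw [coeff_expand two_pos, coeff_contract two_ne_zero]
  split_ifs with hn
  · rw [Nat.div_mul_cancel hn]
  · have h1 := congrArg (coeff · n) h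
    have h2 : (P.comp (-X)).coeff n = (-1) ^ n * P.coeff n := by
      have : (-X : K[X]) = C (-1) * X := by simp
      rw [this, comp_C_mul_X_coeff, mul_comm]
    simp only [h2] at h1
    rw [(Nat.odd_iff.2 (by omega) : Odd n).neg_one_pow, neg_one_mul] at h1
    exact (self_eq_neg.1 h1.symm).symm

/-- Differences of roots come in pairs `±z`, so `R̃` is even and contraction by `2` loses no
coefficient: `T(z²) = R̃(z)`. -/
lemma expand_halvedShiftResultant [CharZero K] {b : K[X]} (hb : 0 < b.natDegree) :
    expand K 2 (halvedShiftResultant b) = reducedShiftResultant b := by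
  obtain ⟨hsq, hroots⟩ := exists_reducedShiftResultant_spec (AlgebraicClosure K) hb
  refine expand_contract_two (comp_neg_X_eq_self (AlgebraicClosure K) hsq (fun h0 => ?_) ?_)
  · refine ((hroots 0).1 ?_).1 rfl
    rw [← map_zero (algebraMap K (AlgebraicClosure K)), aeval_algebraMap_apply]
    simp [h0]
  · intro z hz
    obtain ⟨h0, α, hα, hαz⟩ := (hroots z).1 hz
    exact (hroots _).2 ⟨neg_ne_zero.2 h0, α + z, hαz, by simpa using hα⟩

lemma ShiftSet.mem_iff (L : Type*) [Field L] [Algebra K L] [IsAlgClosed L] [CharZero K]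
    {b : K[X]} {S : Finset ℕ} (h : ShiftSet b S) (ℓ : ℕ) :
    ℓ ∈ S ↔ 1 ≤ ℓ ∧ ∃ α : L, aeval α b = 0 ∧ aeval (α + ℓ) b = 0 := by
  have hL : CharZero L := charZero_of_injective_algebraMap (algebraMap K L).injective
  obtain ⟨hsq, ⟨hb, rfl⟩ | ⟨hb, hS⟩⟩ := h
  · simp only [Finset.notMem_empty, false_iff, not_and, not_exists]
    intro hℓ α hα hα'
    have hb0 := map_ne_zero_of_ne_zero L hsq.1
    have hne : α ≠ α + ℓ := by simp; omega
    -- Two distinct roots contradict degree at most 1, so the early return of the empty set is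
    -- correct.
    have h2 : ({α, α + (ℓ : L)} : Multiset L) ≤ (b.map (algebraMap K L)).roots := by
      rw [Multiset.le_iff_subset (by simp [hne])]
      intro x hx
      rw [mem_roots hb0, IsRoot, eval_map_algebraMap]
      rcases (by simpa using hx : x = α ∨ x = α + ℓ) with rfl | rfl <;> assumption
    have h3 := (Multiset.card_le_card h2).trans (card_roots' _)
    rw [natDegree_map] at h3
    simp at h3
    omega
  · rw [hS, and_congr_right_iff]
    intro hℓ
    obtain ⟨-, hroots⟩ := exists_reducedShiftResultant_spec L (b := b) (by omega)
    have h1 := hroots ℓ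
    rw [← map_natCast (algebraMap K L) ℓ, aeval_algebraMap_apply,
      map_eq_zero_iff _ (algebraMap K L).injective] at h1
    rw [← expand_eval, expand_halvedShiftResultant (by omega), ← coe_aeval_eq_eval, h1,
      map_natCast]
    have : (ℓ : L) ≠ 0 := by simp; omega
    simp [this]

lemma ShiftSet.unique [CharZero K] {b : K[X]} {S S' : Finset ℕ} (h : ShiftSet b S)
    (h' : ShiftSet b S') : S = S' := by
  ext ℓ
  rw [h.mem_iff (AlgebraicClosure K), h'.mem_iff (AlgebraicClosure K)]

lemma exists_shiftSet [CharZero K] {b : K[X]} (hb : IsSquarefreePoly b) : ∃ S, ShiftSet b S := by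
  by_cases hd : b.natDegree ≤ 1
  · exact ⟨∅, hb, Or.inl ⟨hd, rfl⟩⟩
  have hT : halvedShiftResultant b ≠ 0 := by
    intro h
    have := expand_halvedShiftResultant (b := b) (by omega)
    rw [h, map_zero] at this
    exact (exists_reducedShiftResultant_spec (AlgebraicClosure K) (b := b) (by omega)).1.1 this.symm
  have hfin : {ℓ : ℕ | 1 ≤ ℓ ∧ (halvedShiftResultant b).eval ((ℓ : K) ^ 2) = 0}.Finite := by
    have h1 : {x : K | (halvedShiftResultant b).IsRoot x}.Finite := finite_setOfPred_isRoot hT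
    refine (h1.preimage (f := fun ℓ : ℕ => (ℓ : K) ^ 2) ?_).subset fun ℓ hℓ => hℓ.2
    intro x _ y _ hxy
    have hxy' : (x : K) ^ 2 = (y : K) ^ 2 := hxy
    exact Nat.pow_left_injective two_ne_zero (by exact_mod_cast hxy')
  exact ⟨hfin.toFinset, hb, Or.inr ⟨by omega, fun ℓ => by simp⟩⟩

end ShiftSet

/-! ### The shift factorization of a squarefree polynomial -/

section ShiftFactor

variable {K : Type*} [Field K]

lemma polyLcm_polyGcd_dvd (b : K[X]) (S : Finset ℕ) :
    (polyLcm S fun ℓ => polyGcd b (shiftPoly (-(ℓ : ℤ)) b)) ∣ b :=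
  polyLcm_dvd fun _ _ => polyGcd_dvd_left _ _

lemma mul_initialFactor {b : K[X]} (hb : b ≠ 0) (S : Finset ℕ) :
    (polyLcm S fun ℓ => polyGcd b (shiftPoly (-(ℓ : ℤ)) b)) * initialFactor b S = b :=
  EuclideanDomain.mul_div_cancel' (ne_zero_of_dvd_ne_zero hb (polyLcm_polyGcd_dvd b S))
    (polyLcm_polyGcd_dvd b S)

lemma initialFactor_dvd {b : K[X]} (hb : b ≠ 0) (S : Finset ℕ) : initialFactor b S ∣ b :=
  Dvd.intro_left _ (mul_initialFactor hb S)

lemma monic_initialFactor {b : K[X]} (hb : b.Monic) (S : Finset ℕ) :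
    (initialFactor b S).Monic := by
  have h := mul_initialFactor hb.ne_zero S
  refine Monic.of_mul_monic_left (monic_polyLcm ?_) (h ▸ hb)
  exact ne_zero_of_dvd_ne_zero hb.ne_zero (polyLcm_polyGcd_dvd b S)

lemma shiftFactor_zero (b : K[X]) (S : Finset ℕ) : shiftFactor b S 0 = initialFactor b S := by
  simp [shiftFactor]

lemma shiftFactor_dvd {b : K[X]} (hb : b ≠ 0) (S : Finset ℕ) (ℓ : ℕ) :
    shiftFactor b S ℓ ∣ b := by
  unfold shiftFactor
  split_ifs
  · exact initialFactor_dvd hb S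
  · exact polyGcd_dvd_right _ _

lemma monic_shiftFactor {b : K[X]} (hb : b.Monic) (S : Finset ℕ) (ℓ : ℕ) :
    (shiftFactor b S ℓ).Monic := by
  unfold shiftFactor
  split_ifs
  · exact monic_initialFactor hb S
  · exact monic_polyGcd (shiftPoly_ne_zero (monic_initialFactor hb S).ne_zero)

lemma shiftPoly_dvd_shiftPoly (n : ℤ) {p q : K[X]} (h : p ∣ q) :
    shiftPoly n p ∣ shiftPoly n q := by
  obtain ⟨c, rfl⟩ := h
  exact ⟨shiftPoly n c, taylor_mul _ _ _⟩

lemma shiftPoly_shiftPoly_neg (n : ℤ) (p : K[X]) : shiftPoly n (shiftPoly (-n) p) = p := by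
  rw [shiftPoly, shiftPoly, taylor_taylor]
  simp

/-- This places every shifted summand of the reduction over the common denominator `b₀`. -/
lemma shiftPoly_shiftFactor_dvd (b : K[X]) (S : Finset ℕ) (ℓ : ℕ) :
    shiftPoly ℓ (shiftFactor b S ℓ) ∣ initialFactor b S := by
  have h : shiftFactor b S ℓ ∣ shiftPoly (-(ℓ : ℤ)) (initialFactor b S) := by
    unfold shiftFactor
    split_ifs with h
    · simp [h, shiftPoly]
    · exact polyGcd_dvd_left _ _
  have h2 := shiftPoly_dvd_shiftPoly (ℓ : ℤ) h
  rwa [shiftPoly_shiftPoly_neg] at h2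

lemma ShiftSet.isSquarefreePoly_initialFactor {b : K[X]} {S : Finset ℕ} (hS : ShiftSet b S) :
    IsSquarefreePoly (initialFactor b S) :=
  hS.1.of_dvd (initialFactor_dvd hS.1.1 S)

variable (L : Type*) [Field L] [Algebra K L]

lemma ShiftSet.aeval_shiftFactor_eq_zero_iff {b : K[X]} {S : Finset ℕ} (hS : ShiftSet b S)
    (ℓ : ℕ) (α : L) : aeval α (shiftFactor b S ℓ) = 0 ↔
      aeval α b = 0 ∧ aeval (α - ℓ) (initialFactor b S) = 0 := by
  unfold shiftFactor
  split_ifs with h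
  · subst h
    simpa using aeval_eq_zero_of_dvd (initialFactor_dvd hS.1.1 S)
  · rw [aeval_polyGcd_eq_zero_iff, aeval_shiftPoly, and_comm]
    simp [sub_eq_add_neg]

lemma natDegree_pos_of_aeval_eq_zero {p : K[X]} (hp : p ≠ 0) {α : L} (h : aeval α p = 0) :
    1 ≤ p.natDegree := by
  by_contra! h0
  rw [eq_C_of_natDegree_eq_zero (by omega : p.natDegree = 0), aeval_C,
      map_eq_zero_iff _ (algebraMap K _).injective] at h
  exact hp (by rw [eq_C_of_natDegree_eq_zero (by omega : p.natDegree = 0), h, C_0])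

variable [IsAlgClosed L] [CharZero K]

/-- The lcm `G` collects the roots `α` of `b` for which some `α - ℓ` is again a root; such an `ℓ`
belongs to `S` automatically. As `b = G b₀` is squarefree, `b₀` has exactly the remaining roots. -/
lemma ShiftSet.aeval_initialFactor_eq_zero_iff {b : K[X]} {S : Finset ℕ} (hS : ShiftSet b S)
    (α : L) : aeval α (initialFactor b S) = 0 ↔
      aeval α b = 0 ∧ ∀ ℓ : ℕ, 1 ≤ ℓ → aeval (α - ℓ) b ≠ 0 := by
  have hsq := hS.1
  have hmul := mul_initialFactor hsq.1 S
  have hG : aeval α (polyLcm S fun ℓ => polyGcd b (shiftPoly (-(ℓ : ℤ)) b)) = 0 ↔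
      aeval α b = 0 ∧ ∃ ℓ : ℕ, 1 ≤ ℓ ∧ aeval (α - ℓ) b = 0 := by
    simp only [aeval_polyLcm_eq_zero_iff, aeval_polyGcd_eq_zero_iff, aeval_shiftPoly,
      hS.mem_iff L, Int.cast_neg, Int.cast_natCast, ← sub_eq_add_neg]
    constructor
    · rintro ⟨ℓ, ⟨h1, -⟩, h2, h3⟩
      exact ⟨h2, ℓ, h1, h3⟩
    · rintro ⟨h2, ℓ, h1, h3⟩
      exact ⟨ℓ, ⟨h1, α - ℓ, h3, by simpa using h2⟩, h2, h3⟩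
  constructor
  · intro h
    have hb := aeval_eq_zero_of_dvd (initialFactor_dvd hsq.1 S) h
    refine ⟨hb, fun ℓ hℓ h' => ?_⟩
    have h1 := hG.2 ⟨hb, ℓ, hℓ, h'⟩
    rw [← hmul] at hsq
    exact hsq.aeval_ne_zero_of_mul h1 h
  · rintro ⟨hb, h⟩
    have h1 : aeval α (polyLcm S fun ℓ => polyGcd b (shiftPoly (-(ℓ : ℤ)) b)) ≠ 0 := by
      rw [Ne, hG]
      rintro ⟨-, ℓ, hℓ, h'⟩
      exact h ℓ hℓ h'
    rw [← hmul, map_mul] at hb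
    exact (mul_eq_zero.1 hb).resolve_left h1

lemma ShiftSet.isShiftfree_initialFactor {b : K[X]} {S : Finset ℕ} (hS : ShiftSet b S) :
    IsShiftfree (initialFactor b S) := by
  intro ℓ hℓ
  refine isCoprime_of_aeval (AlgebraicClosure K) fun α hα hα' => ?_
  rw [aeval_shiftPoly] at hα'
  rw [hS.aeval_initialFactor_eq_zero_iff (AlgebraicClosure K)] at hα hα'
  exact hα'.2 ℓ hℓ (by simpa using hα.1)

lemma ShiftSet.exists_aeval_initialFactor_eq_zero {b : K[X]} {S : Finset ℕ} (hS : ShiftSet b S)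
    {α : L} (hα : aeval α b = 0) : ∃ ℓ : ℕ, aeval (α - ℓ) (initialFactor b S) = 0 := by
  have hL : CharZero L := charZero_of_injective_algebraMap (algebraMap K L).injective
  have hfin : {n : ℕ | aeval (α - n) b = 0}.Finite :=
    (finite_aeval_eq_zero (L := L) hS.1.1).preimage (f := fun n : ℕ => α - n)
      fun x _ y _ hxy => by simpa using hxy
  -- The largest `n` with `α - n` a root gives the leftmost root of the orbit; it exists because `b`
  -- has finitely many roots and the `α - n` are distinct.
  obtain ⟨n, hn, hmax⟩ := hfin.exists_maximal ⟨0, by simpa using hα⟩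
  refine ⟨n, (hS.aeval_initialFactor_eq_zero_iff L _).2 ⟨hn, fun ℓ hℓ h => ?_⟩⟩
  have h1 : n + ℓ ∈ {n : ℕ | aeval (α - n) b = 0} := by
    simpa [sub_sub] using h
  have := hmax h1 (Nat.le_add_right _ _)
  omega

/-- A common root `α` would make both `α - ℓ` and `α - m` leftmost roots of the same orbit. -/
lemma ShiftSet.isCoprime_shiftFactor {b : K[X]} {S : Finset ℕ} (hS : ShiftSet b S) {ℓ m : ℕ}
    (h : ℓ ≠ m) : IsCoprime (shiftFactor b S ℓ) (shiftFactor b S m) := by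
  wlog hlt : ℓ < m generalizing ℓ m
  · exact (this h.symm (by omega)).symm
  refine isCoprime_of_aeval (AlgebraicClosure K) fun α hα hα' => ?_
  rw [hS.aeval_shiftFactor_eq_zero_iff (AlgebraicClosure K)] at hα hα'
  have h1 := ((hS.aeval_initialFactor_eq_zero_iff _ _).1 hα.2).2 (m - ℓ) (by omega)
  have h2 := ((hS.aeval_initialFactor_eq_zero_iff _ _).1 hα'.2).1
  rw [Nat.cast_sub hlt.le] at h1
  exact h1 (by simpa [sub_sub] using h2)

lemma ShiftSet.one_le_natDegree_shiftFactor {b : K[X]} {S : Finset ℕ} (hS : ShiftSet b S)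
    (hb : 1 ≤ b.natDegree) {ℓ : ℕ} (hℓ : ℓ ∈ shiftIndices b S) :
    1 ≤ (shiftFactor b S ℓ).natDegree := by
  rcases Finset.mem_insert.1 hℓ with rfl | hℓ
  · rw [shiftFactor_zero]
    obtain ⟨α, hα⟩ := IsAlgClosed.exists_aeval_eq_zero (AlgebraicClosure K) b
      (natDegree_pos_iff_degree_pos.1 hb).ne'
    obtain ⟨n, hn⟩ := hS.exists_aeval_initialFactor_eq_zero _ hα
    exact natDegree_pos_of_aeval_eq_zero _ hS.isSquarefreePoly_initialFactor.1 hn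
  · exact (Finset.mem_filter.1 hℓ).2

/-- Pairwise coprime divisors of `b` have product dividing `b`. Conversely every root of `b` is at
some distance `n` from a leftmost root, hence is a root of `b_n`, and squarefreeness turns this into
divisibility. -/
lemma ShiftSet.prod_shiftFactor {b : K[X]} (hb : b.Monic) {S : Finset ℕ} (hS : ShiftSet b S) :
    ∏ ℓ ∈ shiftIndices b S, shiftFactor b S ℓ = b := by
  refine eq_of_monic_of_associated (monic_prod_of_monic _ _ fun ℓ _ => monic_shiftFactor hb S ℓ)
    hb (associated_of_dvd_dvd ?_ ?_)
  · exact Finset.prod_dvd_of_coprime (fun ℓ _ m _ h => hS.isCoprime_shiftFactor h)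
      fun ℓ _ => shiftFactor_dvd hb.ne_zero S ℓ
  · refine hS.1.dvd_of_aeval (AlgebraicClosure K) fun α hα => ?_
    obtain ⟨n, hn⟩ := hS.exists_aeval_initialFactor_eq_zero _ hα
    have h1 := (hS.aeval_shiftFactor_eq_zero_iff _ n α).2 ⟨hα, hn⟩
    have hmem : n ∈ shiftIndices b S := by
      rw [shiftIndices, Finset.mem_insert, Finset.mem_filter, or_iff_not_imp_left]
      intro h0
      refine ⟨(hS.mem_iff (AlgebraicClosure K) n).2 ⟨by omega, α - n,
        ((hS.aeval_initialFactor_eq_zero_iff _ _).1 hn).1, by simpa using hα⟩, ?_⟩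
      exact natDegree_pos_of_aeval_eq_zero _ (monic_shiftFactor hb S n).ne_zero h1
    exact aeval_eq_zero_of_dvd (Finset.dvd_prod_of_mem _ hmem) h1

end ShiftFactor

/-! ### Residues of rational functions over the ground field -/

section Residue

variable {K : Type*} [Field K] {L : Type*} [Field L] [Algebra K L]

lemma polarCoeff_baseChange_frac_eq_zero {k : ℕ} (hk : 0 < k) {α : L} (a : K[X]) {b : K[X]}
    (hb : aeval α b ≠ 0) : polarCoeff k α (baseChange L (frac a b)) = 0 := by
  rw [baseChange_frac]
  exact polarCoeff_eq_zero_of_eval_ne_zero hk _ (by rwa [eval_map_algebraMap])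

lemma polarCoeff_one_baseChange_frac (a : K[X]) {b : K[X]} (hb : IsSquarefreePoly b) {α : L}
    (hα : aeval α b = 0) : polarCoeff 1 α (baseChange L (frac a b)) =
      aeval α a / aeval α (derivative b) := by
  rw [baseChange_frac, polarCoeff_one_eq, derivative_map, eval_map_algebraMap, eval_map_algebraMap]
  · rwa [eval_map_algebraMap]
  · rw [derivative_map, eval_map_algebraMap]
    exact hb.aeval_derivative_ne_zero hα

lemma aeval_num_ne_zero {f : RatFunc K} {α : L} (h : aeval α f.denom = 0) : aeval α f.num ≠ 0 :=
  aeval_ne_zero_of_isCoprime (RatFunc.isCoprime_num_denom f).symm h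

lemma polarCoeff_one_ne_zero {f : RatFunc K} (hf : IsSquarefreePoly f.denom) {α : L}
    (h : aeval α f.denom = 0) : polarCoeff 1 α (baseChange L f) ≠ 0 := by
  rw [← frac_num_denom f, polarCoeff_one_baseChange_frac _ hf h]
  exact div_ne_zero (aeval_num_ne_zero h) (hf.aeval_derivative_ne_zero h)

/-- The Taylor expansion of `p(x + n)` at `α` is that of `p` at `α + n`, so the two Laurent series
coincide. -/
lemma polarCoeff_shift (k : ℕ) (α : L) (n : ℤ) (f : RatFunc K) :
    polarCoeff k α (baseChange L (shift n f)) = polarCoeff k (α + n) (baseChange L f) := by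
  have h : ∀ p : K[X], polyLaurentAt α ((shiftPoly n p).map (algebraMap K L)) =
      polyLaurentAt (α + n) (p.map (algebraMap K L)) := by
    intro p
    have : taylor α ((shiftPoly n p).map (algebraMap K L)) =
        taylor (α + n) (p.map (algebraMap K L)) := by
      have h1 : (shiftPoly n p).map (algebraMap K L) = taylor (n : L) (p.map (algebraMap K L)) := by
        simp [shiftPoly, taylor_apply, map_comp]
      rw [h1, taylor_taylor]
    simp [polyLaurentAt, powerSeriesAt, this]
  change (laurentAt _ _).coeff _ = (laurentAt _ _).coeff _
  rw [← frac_num_denom f, shift_frac, baseChange_frac, baseChange_frac, laurentAt_frac,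
    laurentAt_frac, h, h]

end Residue

/-! ### Sums over orbits -/

section OrbitSum

variable {L : Type*} [Field L]

/-- The sum of the values of `g` over the orbit `ω`. -/
def orbitSum (ω : Orbit L) (g : L → L) : L :=
  ∑ᶠ (α : L) (_ : (α : Orbit L) = ω), g α

lemma orbitSum_eq_zero {ω : Orbit L} {g : L → L} (h : ∀ α : L, (α : Orbit L) = ω → g α = 0) :
    orbitSum ω g = 0 :=
  finsum_mem_eq_zero_of_forall_eq_zero (s := {α : L | (α : Orbit L) = ω}) h

lemma orbitSum_eq_single {g : L → L} (α : L)
    (h : ∀ β : L, (β : Orbit L) = (α : Orbit L) → β ≠ α → g β = 0) :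
    orbitSum (α : Orbit L) g = g α := by
  rw [orbitSum, finsum_eq_single _ α]
  · simp
  · intro β hβ
    by_cases hβ' : (β : Orbit L) = (α : Orbit L)
    · simp [hβ', h β hβ' hβ]
    · simp [hβ']

lemma orbitSum_sum (ω : Orbit L) {ι : Type*} (s : Finset ι) (g : ι → L → L)
    (hg : ∀ i ∈ s, (Function.support (g i)).Finite) :
    orbitSum ω (fun α => ∑ i ∈ s, g i α) = ∑ i ∈ s, orbitSum ω (g i) := by
  have h1 : ∀ g : L → L, orbitSum ω g = ∑ᶠ α, {α : L | (α : Orbit L) = ω}.indicator g α :=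
    fun g => finsum_mem_def _ _
  simp only [h1]
  rw [← finsum_sum_comm]
  · refine finsum_congr fun α => ?_
    simp only [Set.indicator_apply]
    split_ifs <;> simp
  · intro i hi
    exact (hg i hi).subset (by rw [Set.support_indicator]; exact Set.inter_subset_right)

lemma orbitSum_add_int (ω : Orbit L) (g : L → L) (n : ℤ) :
    orbitSum ω (fun α => g (α + n)) = orbitSum ω g := by
  have h1 : ∀ α : L, ((α + n : L) : Orbit L) = (α : Orbit L) := by
    intro α
    rw [eq_comm, QuotientAddGroup.eq]
    exact ⟨n, by simp⟩
  unfold orbitSum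
  refine Eq.trans (finsum_congr fun α => ?_) (finsum_comp_equiv (Equiv.addRight (n : L)))
  simp only [Equiv.coe_addRight, h1]

lemma exists_eq_add_int {α β : L} (h : (β : Orbit L) = (α : Orbit L)) : ∃ n : ℤ, β = α + n := by
  rw [eq_comm, QuotientAddGroup.eq] at h
  obtain ⟨n, hn⟩ := h
  exact ⟨n, by simp at hn; rw [hn]; ring⟩

end OrbitSum

/-! ### Simple reduction -/

section SimpleReduction

variable {K : Type*} [Field K]

lemma eq_zero_of_isProper_algebraMap {q : K[X]} (h : IsProper (algebraMap K[X] (RatFunc K) q)) :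
    q = 0 := by
  rw [IsProper, RatFunc.num_algebraMap, RatFunc.denom_algebraMap, degree_one] at h
  exact degree_eq_bot.1 (Nat.WithBot.lt_zero_iff.1 h)

lemma exists_parFrac [CharZero K] {f : RatFunc K} (hf : IsProper f) {S : Finset ℕ}
    (hS : ShiftSet f.denom S) (hd : 1 ≤ f.denom.natDegree) :
    ∃ a, ParFrac f (shiftIndices f.denom S) (shiftFactor f.denom S) a := by
  have hmonic := RatFunc.monic_denom f
  have hprod := hS.prod_shiftFactor hmonic
  obtain ⟨q, a, ha, h⟩ := div_prod_eq_quo_add_sum_rem_div (RatFunc K) f.num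
    (s := shiftIndices f.denom S) (g := shiftFactor f.denom S)
    (fun ℓ _ => monic_shiftFactor hmonic S ℓ)
    (fun ℓ _ m _ hne => hS.isCoprime_shiftFactor hne)
  have h' : f = algebraMap K[X] (RatFunc K) q +
      ∑ ℓ ∈ shiftIndices f.denom S, frac (a ℓ) (shiftFactor f.denom S ℓ) := by
    refine Eq.trans ?_ h
    simp only [Algebra.cast]
    rw [← map_prod, hprod]
    exact (RatFunc.num_div_denom f).symm
  -- The polynomial part is a difference of proper functions, hence zero.
  have hq : q = 0 := by
    refine eq_zero_of_isProper_algebraMap ?_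
    rw [← sub_eq_iff_eq_add.2 h']
    exact hf.sub (IsProper.sum fun ℓ hℓ => isProper_frac (ha ℓ hℓ))
  rw [hq, map_zero, zero_add] at h'
  refine ⟨a, hf, hd, hS.1, fun ℓ _ => monic_shiftFactor hmonic S ℓ,
    fun ℓ hℓ => hS.one_le_natDegree_shiftFactor hd hℓ, hprod, fun ℓ hℓ h0 => ?_, ha, h'⟩
  -- If `a_ℓ` were zero, `f` would have zero residue at a root of `b_ℓ`, contradicting that its
  -- denominator is reduced and squarefree.
  let L := AlgebraicClosure K
  obtain ⟨α, hα⟩ := IsAlgClosed.exists_aeval_eq_zero L (shiftFactor f.denom S ℓ)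
    (natDegree_pos_iff_degree_pos.1 (hS.one_le_natDegree_shiftFactor hd hℓ)).ne'
  refine polarCoeff_one_ne_zero hS.1 (L := L)
    (aeval_eq_zero_of_dvd (shiftFactor_dvd hmonic.ne_zero S ℓ) hα) ?_
  rw [h', map_sum, map_sum]
  refine Finset.sum_eq_zero fun m hm => ?_
  by_cases hml : m = ℓ
  · rw [hml, h0, frac_zero_left, map_zero, map_zero]
  · exact polarCoeff_baseChange_frac_eq_zero one_pos _
      (aeval_ne_zero_of_isCoprime (hS.isCoprime_shiftFactor (Ne.symm hml)) hα)

lemma ParFrac.unique [CharZero K] {f : RatFunc K} {S : Finset ℕ} (hS : ShiftSet f.denom S)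
    {a a' : ℕ → K[X]}
    (h : ParFrac f (shiftIndices f.denom S) (shiftFactor f.denom S) a)
    (h' : ParFrac f (shiftIndices f.denom S) (shiftFactor f.denom S) a') :
    ∀ ℓ ∈ shiftIndices f.denom S, a ℓ = a' ℓ := by
  refine (quo_add_sum_rem_div_unique (RatFunc K) (q₁ := 0) (q₂ := 0) h.monic
    (fun ℓ _ m _ hne => hS.isCoprime_shiftFactor hne) h.degree_lt h'.degree_lt ?_).2
  congr 1
  exact h.eq.symm.trans h'.eq

lemma one_lt_natDegree_of_ne_empty {b : K[X]} {S : Finset ℕ} (h : ShiftSet b S) (hS : S ≠ ∅) :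
    1 < b.natDegree := by
  rcases h.2 with h | h
  · exact absurd h.2 hS
  · exact h.1

lemma exists_simpleReduction [CharZero K] {f : RatFunc K} (hf : IsProper f)
    (hsq : IsSquarefreePoly f.denom) : ∃ fbar, SimpleReduction f fbar := by
  obtain ⟨S, hS⟩ := exists_shiftSet hsq
  by_cases h : S = ∅
  · exact ⟨f, hf, hsq, S, hS, Or.inl ⟨h, rfl⟩⟩
  · obtain ⟨a, ha⟩ := exists_parFrac hf hS (one_lt_natDegree_of_ne_empty hS h).le
    exact ⟨_, hf, hsq, S, hS, Or.inr ⟨h, a, ha, rfl⟩⟩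

lemma SimpleReduction.unique [CharZero K] {f g g' : RatFunc K} (h : SimpleReduction f g)
    (h' : SimpleReduction f g') : g = g' := by
  obtain ⟨-, -, S, hS, h⟩ := h
  obtain ⟨-, -, S', hS', h'⟩ := h'
  obtain rfl := hS.unique hS'
  obtain ⟨h, rfl⟩ | ⟨h, a, ha, rfl⟩ := h <;> obtain ⟨h', rfl⟩ | ⟨h', a', ha', rfl⟩ := h'
  · rfl
  · exact absurd h h'
  · exact absurd h' h
  · exact Finset.sum_congr rfl fun ℓ hℓ => by rw [ParFrac.unique hS ha ha' ℓ hℓ]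

lemma SimpleReduction.isProper {f g : RatFunc K} (h : SimpleReduction f g) : IsProper g := by
  obtain ⟨hf, -, S, hS, ⟨-, rfl⟩ | ⟨-, a, ha, rfl⟩⟩ := h
  · exact hf
  · exact IsProper.sum fun ℓ hℓ => (isProper_frac (ha.degree_lt ℓ hℓ)).shift _

lemma SimpleReduction.exists_denom_dvd [CharZero K] {f g : RatFunc K} (h : SimpleReduction f g) :
    ∃ b, g.denom ∣ b ∧ IsSquarefreePoly b ∧ IsShiftfree b := by
  obtain ⟨hf, -, S, hS, h⟩ := h
  refine ⟨initialFactor f.denom S, ?_, hS.isSquarefreePoly_initialFactor,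
    hS.isShiftfree_initialFactor⟩
  have h0 := hS.isSquarefreePoly_initialFactor.1
  obtain ⟨rfl, rfl⟩ | ⟨-, a, ha, rfl⟩ := h
  -- For `S = ∅` the empty lcm is 1, so `b₀` is the denominator itself, which is therefore already
  -- shiftfree.
  · rw [initialFactor]
    simp [polyLcm]
  · choose c hc using fun ℓ => shiftPoly_shiftFactor_dvd f.denom S ℓ
    have : ∑ ℓ ∈ shiftIndices f.denom S, shift (ℓ : ℤ) (frac (a ℓ) (shiftFactor f.denom S ℓ)) =
        frac (∑ ℓ ∈ shiftIndices f.denom S, shiftPoly ℓ (a ℓ) * c ℓ)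
          (initialFactor f.denom S) := by
      rw [frac_sum]
      refine Finset.sum_congr rfl fun ℓ _ => ?_
      have hcl : c ℓ ≠ 0 := by
        intro h
        rw [hc ℓ, h, mul_zero] at h0
        exact h0 rfl
      rw [shift_frac]
      conv_rhs => rw [hc ℓ]
      rw [frac_mul_mul_right hcl]
    rw [this]
    exact denom_frac_dvd _ _

lemma IsShiftfree.of_dvd {a b : K[X]} (hb : IsShiftfree b) (h : a ∣ b) : IsShiftfree a :=
  fun ℓ hℓ => ((hb ℓ hℓ).of_isCoprime_of_dvd_left h).of_isCoprime_of_dvd_right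
    (shiftPoly_dvd_shiftPoly _ h)

lemma SimpleReduction.squarefree [CharZero K] {f g : RatFunc K} (h : SimpleReduction f g) :
    IsSquarefreePoly g.denom :=
  let ⟨_, hd, hsq, _⟩ := h.exists_denom_dvd
  hsq.of_dvd hd

lemma SimpleReduction.shiftfree [CharZero K] {f g : RatFunc K} (h : SimpleReduction f g) :
    IsShiftfree g.denom :=
  let ⟨_, hd, _, hsf⟩ := h.exists_denom_dvd
  hsf.of_dvd hd

/-- Each summand is only translated by an integer, which permutes its residues within every orbit.
-/
lemma SimpleReduction.orbitSum_eq {L : Type*} [Field L] [Algebra K L] {f g : RatFunc K}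
    (h : SimpleReduction f g) (ω : Orbit L) :
    orbitSum ω (fun α => polarCoeff 1 α (baseChange L f)) =
      orbitSum ω (fun α => polarCoeff 1 α (baseChange L g)) := by
  obtain ⟨-, -, S, hS, ⟨-, rfl⟩ | ⟨-, a, ha, rfl⟩⟩ := h
  · rfl
  · conv_lhs => rw [ha.eq]
    simp only [map_sum, polarCoeff_shift]
    have hfin : ∀ F : RatFunc L, (Function.support fun α => polarCoeff 1 α F).Finite :=
      fun F => finite_setOf_polarCoeff_ne_zero one_pos F
    rw [orbitSum_sum _ _ _ fun _ _ => hfin _, orbitSum_sum _ _ _ fun ℓ _ => ?_]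
    · exact Finset.sum_congr rfl fun ℓ _ => (orbitSum_add_int ω _ (ℓ : ℤ)).symm
    · simp only [← polarCoeff_shift]
      exact hfin _

end SimpleReduction

/-! ### First residues -/

section FirstResidues

variable {K : Type*} [Field K]

lemma exists_firstResidues {f : RatFunc K} (hf : IsProper f) (hsq : IsSquarefreePoly f.denom) :
    ∃ br, FirstResidues f br := by
  by_cases h : f = 0
  · exact ⟨_, Or.inl ⟨h, rfl⟩⟩
  obtain ⟨t, s, ht, hts⟩ := exists_mul_derivative_add hsq f.num
  exact ⟨(f.denom, t), Or.inr ⟨h, hf, hsq, rfl, ht, -s, by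
    simp only
    linear_combination -hts⟩⟩

lemma FirstResidues.unique {f : RatFunc K} {br br' : K[X] × K[X]} (h : FirstResidues f br)
    (h' : FirstResidues f br') : br = br' := by
  obtain ⟨h0, rfl⟩ | ⟨h0, -, hsq, h1, h2, h3⟩ := h <;>
    obtain ⟨h0', rfl⟩ | ⟨h0', -, -, h1', h2', h3'⟩ := h'
  · rfl
  · exact absurd h0 h0'
  · exact absurd h0' h0
  · refine Prod.ext (h1.trans h1'.symm) (sub_eq_zero.1 ?_)
    have hd : f.denom ∣ (br.2 - br'.2) * derivative f.denom := by
      have := dvd_sub h3 h3'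
      rwa [sub_sub_sub_cancel_right, ← sub_mul] at this
    exact eq_zero_of_dvd_of_degree_lt (hsq.2.dvd_of_dvd_mul_right hd)
      ((degree_sub_le _ _).trans_lt (max_lt h2 h2'))

end FirstResidues

/-! ### Correctness of the procedure -/

section Main

variable {K : Type*} [Field K]

lemma FirstResidues.fst_eq_denom {f : RatFunc K} {br : K[X] × K[X]} (h : FirstResidues f br) :
    br.1 = f.denom := by
  obtain ⟨rfl, rfl⟩ | ⟨-, -, -, h, -⟩ := h
  · simp
  · exact h

lemma FirstResidues.degree_lt {f : RatFunc K} {br : K[X] × K[X]} (h : FirstResidues f br) :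
    br.2.degree < br.1.degree := by
  rw [h.fst_eq_denom]
  obtain ⟨rfl, rfl⟩ | ⟨-, -, -, -, h, -⟩ := h
  · simp
  · exact h

lemma FirstResidues.polarCoeff_one_eq {f : RatFunc K} {br : K[X] × K[X]}
    (h : FirstResidues f br) {L : Type*} [Field L] [Algebra K L] {α : L}
    (hα : aeval α f.denom = 0) : polarCoeff 1 α (baseChange L f) = aeval α br.2 := by
  obtain ⟨rfl, rfl⟩ | ⟨-, -, hsq, -, -, c, hc⟩ := h
  · simp at hα
  · conv_lhs => rw [← frac_num_denom f]
    rw [polarCoeff_one_baseChange_frac _ hsq hα, div_eq_iff (hsq.aeval_derivative_ne_zero hα)]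
    have := congrArg (aeval α) hc
    simp only [map_sub, map_mul, hα, zero_mul] at this
    exact (sub_eq_zero.1 this).symm

lemma IsShiftfree.aeval_add_int_ne_zero {b : K[X]} (hb : IsShiftfree b) {L : Type*} [Field L]
    [Algebra K L] {α : L} (hα : aeval α b = 0) {n : ℤ} (hn : n ≠ 0) : aeval (α + n) b ≠ 0 := by
  intro h
  obtain ⟨m, rfl | rfl⟩ := n.eq_nat_or_neg
  · have := aeval_ne_zero_of_isCoprime (hb m (by omega)) hα
    rw [aeval_shiftPoly] at this
    exact this h
  -- For a negative translation the roles of the two roots are exchanged.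
  · have := aeval_ne_zero_of_isCoprime (hb m (by omega)) h
    rw [aeval_shiftPoly] at this
    exact this (by simpa using hα)

/-- If the denominator of `f` is shiftfree, then each orbit contains at most one pole of `f`, and
the sum of the residues of `f` over the orbit of a pole is the residue at that pole. -/
lemma orbitSum_polarCoeff_one {f : RatFunc K} (hsf : IsShiftfree f.denom) {L : Type*} [Field L]
    [Algebra K L] {α : L} (hα : aeval α f.denom = 0) :
    orbitSum (α : Orbit L) (fun β => polarCoeff 1 β (baseChange L f)) =
      polarCoeff 1 α (baseChange L f) := by
  refine orbitSum_eq_single (g := fun β => polarCoeff 1 β (baseChange L f)) α fun β hβ hne => ?_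
  obtain ⟨n, rfl⟩ := exists_eq_add_int hβ
  have hn : n ≠ 0 := by rintro rfl; simp at hne
  rw [← frac_num_denom f]
  exact polarCoeff_baseChange_frac_eq_zero one_pos _ (hsf.aeval_add_int_ne_zero hα hn)

/-- Properness supplies a decomposition with `p = 0`. Whichever one is chosen has the same
coefficients, since polynomials have no polar part. -/
lemma partialFractionCoeff_eq (L : Type*) [Field L] [Algebra K L] [IsAlgClosed L] {f : RatFunc K}
    (hf : IsProper f) (k : ℕ+) (α : L) :
    partialFractionCoeff L f (k, α) = polarCoeff k α (baseChange L f) := by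
  have hex : ∃ c : ℕ+ × L →₀ L, ∃ p : K[X], IsPartialFractionDecomposition f p c := by
    obtain ⟨c, hc⟩ := (hf.baseChange L).exists_eq_polarSum
    exact ⟨c, 0, by rw [IsPartialFractionDecomposition, hc]; simp [polarSum]⟩
  rw [partialFractionCoeff, dif_pos hex]
  obtain ⟨p, hp⟩ := hex.choose_spec
  have h0 : polarCoeff k α (algebraMap L[X] (RatFunc L) (p.map (algebraMap K L))) = 0 := by
    have := polarCoeff_eq_zero_of_eval_ne_zero k.pos (α := α) (p.map (algebraMap K L)) (b := 1)
      (by simp)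
    rwa [frac, map_one, div_one] at this
  rw [hp, map_add, h0, zero_add]
  exact (polarCoeff_polarSum _ k α).symm

lemma neg_one_pow_mul_factorial_mul (i : ℕ) (h : RatFunc K) :
    (-1) ^ i * (i.factorial : RatFunc K) * h = RatFunc.C ((-1) ^ i * (i.factorial : K)) * h := by
  simp

lemma isSquarefreePoly_denom_C_mul {f : RatFunc K} (hf : IsSquarefreePoly f.denom) (v : K) :
    IsSquarefreePoly (RatFunc.C v * f).denom := by
  refine hf.of_dvd ?_
  have : RatFunc.C v * f = frac (C v * f.num) f.denom := by
    conv_lhs => rw [← frac_num_denom f]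
    simp [frac, mul_div_assoc]
  rw [this]
  exact denom_frac_dvd _ _

lemma HermiteList.isProper_and_squarefree {f : RatFunc K} {l : List (RatFunc K)}
    (h : HermiteList f l) : ∀ g ∈ l, IsProper g ∧ IsSquarefreePoly g.denom := by
  obtain ⟨-, -, fhat, hloop, rfl⟩ := h
  intro g hg
  obtain ⟨i, hi, rfl⟩ := List.mem_mapIdx.1 hg
  have := hloop.isProper_and_squarefree _ (List.getElem_mem hi)
  rw [neg_one_pow_mul_factorial_mul]
  exact ⟨this.1.C_mul _, isSquarefreePoly_denom_C_mul this.2 _⟩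

lemma HermiteList.unique [CharZero K] {f : RatFunc K} {l l' : List (RatFunc K)}
    (h : HermiteList f l) (h' : HermiteList f l') : l = l' := by
  obtain ⟨-, -, fhat, hloop, rfl⟩ := h
  obtain ⟨-, -, fhat', hloop', rfl⟩ := h'
  rw [hloop.unique hloop']

lemma HermiteList.polarCoeff_eq (L : Type*) [Field L] [Algebra K L] [IsAlgClosed L]
    {f : RatFunc K} {l : List (RatFunc K)} (h : HermiteList f l) {i : ℕ} (hi : i < l.length)
    (α : L) : polarCoeff (i + 1) α (baseChange L f) = polarCoeff 1 α (baseChange L l[i]) := by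
  obtain ⟨-, -, fhat, hloop, rfl⟩ := h
  have hi' : i < fhat.length := by simpa using hi
  have hb : ∀ v : K, baseChange L (RatFunc.C v) = RatFunc.C (algebraMap K L v) := by
    intro v
    have := baseChange_frac L (C v) 1
    simpa [frac, ← RatFunc.algebraMap_C] using this
  rw [hloop.polarCoeff_eq L, List.getElem_mapIdx, neg_one_pow_mul_factorial_mul, map_mul, hb,
    polarCoeff_C_mul, List.getD_eq_getElem _ _ hi']
  simp

lemma HermiteList.polarCoeff_eq_zero (L : Type*) [Field L] [Algebra K L] [IsAlgClosed L]
    {f : RatFunc K} {l : List (RatFunc K)} (h : HermiteList f l) {k : ℕ} (hk : l.length < k)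
    (α : L) : polarCoeff k α (baseChange L f) = 0 := by
  obtain ⟨-, -, fhat, hloop, rfl⟩ := h
  obtain ⟨i, rfl⟩ : ∃ i, k = i + 1 := ⟨k - 1, by omega⟩
  rw [hloop.polarCoeff_eq L, List.getD_eq_default _ _ (by simpa [Nat.lt_succ_iff] using hk)]
  simp

/-- Coprimality of numerator and denominator survives the extension by Bézout, so no cancellation
appears and pole orders can be computed over `L`. -/
lemma denom_baseChange (L : Type*) [Field L] [Algebra K L] (f : RatFunc K) :
    (baseChange L f).denom = f.denom.map (algebraMap K L) := by
  have hd := map_ne_zero_of_ne_zero L (RatFunc.denom_ne_zero f)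
  have h : baseChange L f = frac (f.num.map (algebraMap K L)) (f.denom.map (algebraMap K L)) := by
    rw [← baseChange_frac, frac_num_denom]
  refine eq_of_monic_of_associated (RatFunc.monic_denom _) ((RatFunc.monic_denom f).map _)
    (associated_of_dvd_dvd (h ▸ denom_frac_dvd _ _) ?_)
  have hmul := num_mul_eq (a := f.num.map (algebraMap K L)) hd
  rw [← h] at hmul
  have hco : IsCoprime (f.denom.map (algebraMap K L)) (f.num.map (algebraMap K L)) :=
    (RatFunc.isCoprime_num_denom f).symm.map (mapRingHom (algebraMap K L))
  exact hco.dvd_of_dvd_mul_left (Dvd.intro_left _ hmul)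

lemma exists_forall₂ {α β : Type*} {R : α → β → Prop} (l : List α)
    (h : ∀ a ∈ l, ∃ b, R a b) : ∃ s, List.Forall₂ R l s := by
  induction l with
  | nil => exact ⟨[], .nil⟩
  | cons a l ih =>
    obtain ⟨b, hb⟩ := h a (by simp)
    obtain ⟨s, hs⟩ := ih fun a ha => h a (by simp [ha])
    exact ⟨b :: s, .cons hb hs⟩

lemma exists_discreteResiduesRun [CharZero K] {f : RatFunc K} (hf : f ≠ 0) (hp : IsProper f) :
    ∃ s, DiscreteResiduesRun f s := by
  obtain ⟨fhat, hloop⟩ := exists_hermiteLoop hp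
  have hl : HermiteList f _ := ⟨hf, hp, fhat, hloop, rfl⟩
  obtain ⟨s, hs⟩ := exists_forall₂
    (R := fun fk BD => ∃ fbar, SimpleReduction fk fbar ∧ FirstResidues fbar BD) _ fun g hg => by
      obtain ⟨h1, h2⟩ := hl.isProper_and_squarefree g hg
      obtain ⟨fbar, hfbar⟩ := exists_simpleReduction h1 h2
      obtain ⟨br, hbr⟩ := exists_firstResidues hfbar.isProper hfbar.squarefree
      exact ⟨br, fbar, hfbar, hbr⟩
  exact ⟨s, _, hl, hs⟩

lemma DiscreteResiduesRun.unique [CharZero K] {f : RatFunc K} {s s' : List (K[X] × K[X])}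
    (h : DiscreteResiduesRun f s) (h' : DiscreteResiduesRun f s') : s = s' := by
  obtain ⟨l, hl, hs⟩ := h
  obtain ⟨l', hl', hs'⟩ := h'
  obtain rfl := hl.unique hl'
  refine List.right_unique_forall₂' ?_ hs hs'
  rintro g br br' ⟨fbar, h1, h2⟩ ⟨fbar', h1', h2'⟩
  obtain rfl := h1.unique h1'
  exact h2.unique h2'

lemma DiscreteResiduesRun.isRationalSystem [CharZero K] (L : Type*) [Field L] [Algebra K L]
    [IsAlgClosed L] {f : RatFunc K} (hp : IsProper f) {s : List (K[X] × K[X])}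
    (h : DiscreteResiduesRun f s) : IsRationalSystem L f s := by
  obtain ⟨l, hl, hs⟩ := h
  have hlen := hs.length_eq
  have key : ∀ (i : ℕ) (hi : i < s.length), ∃ g : RatFunc K, IsSquarefreePoly g.denom ∧
      IsShiftfree g.denom ∧ FirstResidues g s[i] ∧ ∀ ω : Orbit L, dres f ω i.succPNat =
        orbitSum ω fun α => polarCoeff 1 α (baseChange L g) := by
    intro i hi
    obtain ⟨g, h1, h2⟩ := hs.get (hlen ▸ hi) hi
    refine ⟨g, h1.squarefree, h1.shiftfree, h2, fun ω => ?_⟩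
    rw [← h1.orbitSum_eq]
    change orbitSum ω _ = _
    congr 1
    ext α
    rw [partialFractionCoeff_eq L hp, Nat.succPNat_coe, Nat.succ_eq_add_one,
      hl.polarCoeff_eq L (hlen ▸ hi)]
    rfl
  refine ⟨fun α => ?_, fun i hi => ?_, fun i hi => ?_, fun i hi => ?_, fun i hi => ?_,
    fun i hi ω h => ?_, fun i hi α h => ?_⟩
  · rw [← denom_baseChange]
    exact rootMultiplicity_denom_le fun k hk => hl.polarCoeff_eq_zero L (by omega) α
  all_goals obtain ⟨g, hsq, hsf, hfr, hd⟩ := key i hi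
  · rw [hfr.fst_eq_denom]
    exact hsq.1
  · rwa [hfr.fst_eq_denom]
  · rwa [hfr.fst_eq_denom]
  · exact hfr.degree_lt
  · rw [hd]
    refine orbitSum_eq_zero fun α hα => ?_
    rw [← frac_num_denom g]
    exact polarCoeff_baseChange_frac_eq_zero one_pos _ (by
      rw [← hfr.fst_eq_denom]
      exact h α hα)
  · rw [hfr.fst_eq_denom] at h
    rw [hd, orbitSum_polarCoeff_one hsf h, hfr.polarCoeff_one_eq h]

end Main

end

end DiscreteResidues

theorem theorem6p2 {K : Type*} [Field K] [CharZero K]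
    (L : Type*) [Field L] [Algebra K L] [IsAlgClosure K L]
    (f : RatFunc K) (hf : f ≠ 0) (hproper : DiscreteResidues.IsProper f) :
    (∃! s : List (Polynomial K × Polynomial K), DiscreteResidues.DiscreteResiduesRun f s) ∧
      ∀ s : List (Polynomial K × Polynomial K), DiscreteResidues.DiscreteResiduesRun f s →
        DiscreteResidues.IsRationalSystem L f s := by
  have : IsAlgClosed L := IsAlgClosure.isAlgClosed K
  obtain ⟨s, hs⟩ := DiscreteResidues.exists_discreteResiduesRun hf hproper
  exact ⟨⟨s, hs, fun s' hs' => hs'.unique hs⟩, fun s hs => hs.isRationalSystem L hproper⟩
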